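/- Let $V=(v_1,\dots,v_m)$ be a family of points of $\mathbb{R}^d$ with $\dim\operatorname{conv}(V)=d$, and let $r$ be an interior point of $\operatorname{conv}(V)$. A set $I\subseteq\{1,\dots,m\}$ is called $r$-balanced if $r\in\operatorname{conv}\{v_i : i\in I\}$; the nonempty sets $I$ that are not $r$-balanced are the simplices of a simplicial complex $\mathcal K(V,r)$. Write $\tau_r(x)=(x-r)/\|x-r\|$ for $x\neq r$, and let $\pi:|\mathcal K(V,r)|\to\mathbb{R}^d\setminus\{r\}$ be the map that is affine on each simplex and sends the vertex $i$ to $v_i$. For spaces $X,Y$, $[X,Y]$ denotes the set of free homotopy classes of continuous maps $X\to Y$. Let $T$ be a paracompact Hausdorff space. If $\mathcal F=(F_1,\dots,F_m)$ is an open cover of $T$ such that $\bigcap_{i\in I}F_i=\emptyset$ for every $r$-balanced $I$, let $[\mathcal F_{(V,r)}]\in[T,S^{d-1}]$ be the class of the map $x\mapsto\tau_r\bigl(\sum_i\varphi_i(x)v_i\bigr)$, where $(\varphi_i)$ is any partition of unity subordinate to $\mathcal F$ (the class does not depend on it); otherwise $[\mathcal F_{(V,r)}]$ is undefined. If $K$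 is a triangulation of $T$, i.e. a simplicial complex with a homeomorphism $|K|\cong T$, where $|K|$ has the weak topology, and $L:\mathrm{Vert}(K)\to\{1,\dots,m\}$ is a coloring such that $L(\sigma)$ is not $r$-balanced for any simplex $\sigma$ of $K$, let $[L_{(V,r)}]\in[T,S^{d-1}]$ be the class of $T\cong|K|\xrightarrow{f_L}\mathbb{R}^d\setminus\{r\}\xrightarrow{\tau_r}S^{d-1}$, where $f_L$ is affine on each simplex and sends a vertex $u$ to $v_{L(u)}$; otherwise $[L_{(V,r)}]$ is undefined. Let $h\in[T,S^{d-1}]$. Then: 1. There is an open cover $\mathcal F=(F_1,\dots,F_m)$ of $T$ for which $[\mathcal F_{(V,r)}]$ is defined and $[\mathcal F_{(V,r)}]=h$. Moreover, $\mathcal F$ can be obtained by pulling back the star cover of $\mathcal K(V,r)$: there is a continuous map $f:T\to|\mathcal K(V,r)|$ with $[\tau_r\circ\pi\circ f]=h$ such that, for every $i$, $F_i=f^{-1}(U_i)$, where $U_i$ is the open star of $i$, i.e. the set of points of $|\mathcal K(V,r)|$ whose $i$-th barycentric coordinate is positive (so $U_i=\emptyset$ if $i$ is not a vertex). 2. If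 $T$ is a simplicial complex (i.e. $T$ admits a triangulation), then there are a triangulation $K$ of $T$ and a coloring $L:\mathrm{Vert}(K)\to\{1,\dots,m\}$ for which $[L_{(V,r)}]$ is defined and $[L_{(V,r)}]=h$. -/

import Mathlib

open Set TopologicalSpace

noncomputable section

namespace BalancedCover

universe u v

/-- Euclidean space `ℝ^d`. -/
abbrev E (d : ℕ) : Type := EuclideanSpace ℝ (Fin d)

/-- The unit sphere `S^{d-1}` in `ℝ^d`. -/
abbrev Sph (d : ℕ) : Type := Metric.sphere (0 : E d) 1

/-- Homotopy of continuous maps as an equivalence relation. -/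
def homotopySetoid (X : Type u) (Y : Type v) [TopologicalSpace X] [TopologicalSpace Y] :
    Setoid C(X, Y) :=
  ⟨ContinuousMap.Homotopic, ContinuousMap.Homotopic.equivalence⟩

/-- The set `[X, Y]` of (free) homotopy classes of continuous maps. -/
def HomotopyClass (X : Type u) (Y : Type v) [TopologicalSpace X] [TopologicalSpace Y] :
    Type (max u v) :=
  Quotient (homotopySetoid X Y)

/-- The homotopy class of a continuous map. -/
def homotopyClass {X : Type u} {Y : Type v} [TopologicalSpace X] [TopologicalSpace Y]
    (f : C(X, Y)) : HomotopyClass X Y :=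
  Quotient.mk (homotopySetoid X Y) f

/-! ### Geometric realization of a simplicial complex -/

/-- The points of the geometric realization `|K|`, in barycentric coordinates. -/
def Realization {ι : Type u} (K : PreAbstractSimplicialComplex ι) : Type u :=
  {x : ι →₀ ℝ // x.support ∈ K.faces ∧ (∀ i, 0 ≤ x i) ∧ (x.sum fun _ t => t) = 1}

namespace Realization

variable {ι : Type u} {K : PreAbstractSimplicialComplex ι}

/-- The barycentric coordinates of a point of `|K|`. -/
def coord (x : Realization K) : ι →₀ ℝ := x.1

variable (K) in
/-- The closed simplex of `|K|` spanned by a face `s`. -/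
def ClosedSimplex (s : Finset ι) : Type u := {x : Realization K // x.coord.support ⊆ s}

/-- The inclusion of a closed simplex into `|K|`. -/
def ClosedSimplex.incl {s : Finset ι} (x : ClosedSimplex K s) : Realization K := x.1

/-- The Euclidean topology of a closed simplex, given by the barycentric coordinates (only finitely
many of which are nonzero on the simplex). -/
instance (s : Finset ι) : TopologicalSpace (ClosedSimplex K s) :=
  TopologicalSpace.induced (fun x (i : ι) => (x.incl.coord i : ℝ)) inferInstance

/-- The weak topology on `|K|`: a subset of `|K|` is open iff its trace on every closed simplex is
open. -/
instance : TopologicalSpace (Realization K) :=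
  ⨆ s : K.faces, TopologicalSpace.coinduced
    (ClosedSimplex.incl : ClosedSimplex K (s : Finset ι) → Realization K) inferInstance

/-- A map that is given on every closed simplex by a continuous function of the barycentric
coordinates of its vertices is continuous. -/
theorem continuous_of_forall_face {Y : Type*} [TopologicalSpace Y] (f : Realization K → Y)
    (h : ∀ s ∈ K.faces, ∃ g : (ι → ℝ) → Y, Continuous g ∧
      ∀ x : Realization K, x.coord.support ⊆ s → f x = g x.coord) : Continuous f := by
  refine continuous_iSup_dom.2 fun s => continuous_coinduced_dom.2 ?_
  obtain ⟨g, hg, hfg⟩ := h s s.2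
  have : f ∘ (ClosedSimplex.incl : ClosedSimplex K (s : Finset ι) → Realization K)
      = g ∘ fun x i => x.incl.coord i := by
    funext x
    exact hfg x.1 x.2
  rw [this]
  exact hg.comp continuous_induced_dom

theorem continuous_coord (i : ι) : Continuous fun x : Realization K => x.coord i :=
  continuous_of_forall_face _ fun _ _ => ⟨fun y => y i, continuous_apply i, fun _ _ => rfl⟩

/-- The open star of the vertex `i` in `|K|`: the points that lie in no simplex which does not
contain `i`, i.e. the points whose `i`-th barycentric coordinate is positive. -/
def openStar (K : PreAbstractSimplicialComplex ι) (i : ι) : Opens (Realization K) :=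
  ⟨{x | 0 < x.coord i}, isOpen_lt continuous_const (continuous_coord i)⟩

/-- The map `|K| → ℝ^d` that sends the vertex `i` to `w i` and is affine on each simplex. -/
def affineMap {d : ℕ} (K : PreAbstractSimplicialComplex ι) (w : ι → E d) : C(Realization K, E d) where
  toFun x := x.coord.sum fun i t => t • w i
  continuous_toFun := by
    refine continuous_of_forall_face _ fun s _ => ⟨fun y => ∑ i ∈ s, y i • w i, by fun_prop, ?_⟩
    intro x hx
    exact Finsupp.sum_of_support_subset _ hx _ (by simp)

theorem affineMap_mem {d : ℕ} (w : ι → E d) (x : Realization K) :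
    affineMap K w x ∈ convexHull ℝ (w '' x.coord.support) := by
  change (∑ i ∈ x.coord.support, x.coord i • w i) ∈ _
  exact (convex_convexHull ℝ _).sum_mem (fun i _ => x.2.2.1 i) x.2.2.2
    (fun i hi => subset_convexHull ℝ _ ⟨i, hi, rfl⟩)

end Realization

/-- A triangulation of a topological space: a simplicial complex, all of whose labels are vertices,
together with a homeomorphism from its geometric realization to the space. Since the vertices
inject into the space, it is no loss that they live in the universe of the space. -/
structure Triangulation (T : Type u) [TopologicalSpace T] where
  /-- the set of vertices -/
  Vertex : Type u
  /-- the simplicial complex -/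
  complex : AbstractSimplicialComplex Vertex
  /-- the homeomorphism `|K| ≅ T` -/
  homeo : Realization complex.toPreAbstractSimplicialComplex ≃ₜ T

/-! ### The radial projection onto the sphere -/

section radial

variable {X : Type u} [TopologicalSpace X] {d : ℕ}

/-- The composition of a map that misses `r` with the radial projection
`x ↦ (x - r) / ‖x - r‖` onto the unit sphere. -/
def radial (r : E d) (f : C(X, E d)) (hf : ∀ x, f x ≠ r) : C(X, Sph d) where
  toFun x := ⟨‖f x - r‖⁻¹ • (f x - r), by
    have h : ‖f x - r‖ ≠ 0 := norm_ne_zero_iff.2 (sub_ne_zero.2 (hf x))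
    rw [mem_sphere_zero_iff_norm, norm_smul, norm_inv, norm_norm, inv_mul_cancel₀ h]⟩
  continuous_toFun := by
    refine Continuous.subtype_mk (Continuous.smul (Continuous.inv₀
      (f.continuous.sub continuous_const).norm fun x => ?_) (f.continuous.sub continuous_const)) _
    exact norm_ne_zero_iff.2 (sub_ne_zero.2 (hf x))

theorem radial_homotopic (r : E d) (f g : C(X, E d)) (hf : ∀ x, f x ≠ r) (hg : ∀ x, g x ≠ r)
    (h : ∀ x, r ∉ segment ℝ (f x) (g x)) :
    homotopyClass (radial r f hf) = homotopyClass (radial r g hg) := by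
  refine Quotient.sound (s := homotopySetoid _ _) (?_ : ContinuousMap.Homotopic _ _)
  let H : C(unitInterval × X, E d) :=
    ⟨fun p => (1 - (p.1 : ℝ)) • f p.2 + (p.1 : ℝ) • g p.2, by fun_prop⟩
  have hH : ∀ p, H p ≠ r := fun p hp => h p.2
    ⟨1 - p.1, p.1, sub_nonneg.2 p.1.2.2, p.1.2.1, by ring, hp⟩
  refine ⟨⟨radial r H hH, fun x => ?_, fun x => ?_⟩⟩
  · apply Subtype.ext
    simp [radial, H]
  · apply Subtype.ext
    simp [radial, H]

end radial

/-! ### Balanced sets and the non-balanced complex -/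

section balanced

variable {m d : ℕ}

/-- A set `I` of indices is `r`-balanced if `r ∈ conv {v_i | i ∈ I}`. -/
def IsBalanced (v : Fin m → E d) (r : E d) (I : Finset (Fin m)) : Prop :=
  r ∈ convexHull ℝ (v '' (I : Set (Fin m)))

/-- The simplicial complex `K(V, r)` of non-balanced sets of indices. -/
def nonBalancedComplex (v : Fin m → E d) (r : E d) : PreAbstractSimplicialComplex (Fin m) where
  faces := {I | I.Nonempty ∧ ¬ IsBalanced v r I}
  isRelLowerSet_faces := fun _ hI => ⟨hI.1, fun _ hJI hJ =>
    ⟨hJ, fun h => hI.2 (convexHull_mono (image_mono (Finset.coe_subset.2 hJI)) h)⟩⟩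

/-- The map `|K| → ℝ^d \ {r} → S^{d-1}` obtained from the affine extension of `w : Vert(K) → ℝ^d`
by radial projection, when no simplex of `K` is mapped onto a simplex containing `r`. -/
def sphereMap {ι : Type u} (K : PreAbstractSimplicialComplex ι) (w : ι → E d) (r : E d)
    (h : ∀ s ∈ K.faces, r ∉ convexHull ℝ (w '' (s : Set ι))) : C(Realization K, Sph d) :=
  radial r (Realization.affineMap K w) fun x hx =>
    h _ x.2.1 (hx ▸ Realization.affineMap_mem w x)

/-- The map `|K(V, r)| → S^{d-1}`. -/
def nonBalancedSphereMap (v : Fin m → E d) (r : E d) :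
    C(Realization (nonBalancedComplex v r), Sph d) :=
  sphereMap (nonBalancedComplex v r) v r fun _ hs => hs.2

/-! ### The homotopy class of a cover -/

variable {T : Type u} [TopologicalSpace T]

/-- The nerve of a family of sets. -/
def nerve (F : Fin m → Opens T) : PreAbstractSimplicialComplex (Fin m) where
  faces := {I | I.Nonempty ∧ (⋂ i ∈ I, (F i : Set T)).Nonempty}
  isRelLowerSet_faces := fun _ hI => ⟨hI.1, fun _ hJI hJ =>
    ⟨hJ, hI.2.mono (biInter_subset_biInter_left hJI)⟩⟩

/-- The nerve of the family has no `r`-balanced simplex. -/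
def NoBalancedSimplex (v : Fin m → E d) (r : E d) (F : Fin m → Opens T) : Prop :=
  ∀ I ∈ (nerve F).faces, ¬ IsBalanced v r I

/-- The map `ρ(x) = ∑ φ_i(x) v_i` defined by a partition of unity. -/
def rho (v : Fin m → E d) (Φ : PartitionOfUnity (Fin m) T) : C(T, E d) where
  toFun x := ∑ i, Φ i x • v i
  continuous_toFun := by fun_prop

/-- Points of `T` are sent by `ρ` into the hull of the points `v_i` with `x ∈ F_i`. -/
theorem rho_mem (v : Fin m → E d) (Φ : PartitionOfUnity (Fin m) T) (F : Fin m → Opens T)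
    (hΦ : Φ.IsSubordinate fun i => F i) (x : T) :
    rho v Φ x ∈ convexHull ℝ (v '' {i | x ∈ F i}) := by
  have hmem : ∀ i, Φ i x ≠ 0 → x ∈ F i := fun i hi => hΦ i (subset_tsupport _ hi)
  have h1 : ∑ i ∈ Φ.finsupport x, Φ i x = 1 := Φ.sum_finsupport (mem_univ x)
  have h2 : rho v Φ x = ∑ i ∈ Φ.finsupport x, Φ i x • v i := by
    refine (Finset.sum_subset (Finset.subset_univ (Φ.finsupport x)) fun i _ hi => ?_).symm
    have : Φ i x = 0 := by simpa using hi
    rw [this, zero_smul]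
  rw [h2]
  exact (convex_convexHull ℝ _).sum_mem (fun i _ => Φ.nonneg i x) h1
    fun i hi => subset_convexHull ℝ _ ⟨i, hmem i (by simpa using hi), rfl⟩

theorem NoBalancedSimplex.notMem {v : Fin m → E d} {r : E d} {F : Fin m → Opens T}
    (h : NoBalancedSimplex v r F) (x : T) : r ∉ convexHull ℝ (v '' {i | x ∈ F i}) := by
  classical
  intro hr
  let I : Finset (Fin m) := Finset.univ.filter fun i => x ∈ F i
  have hI : (I : Set (Fin m)) = {i | x ∈ F i} := by
    ext i
    simp [I]
  rcases I.eq_empty_or_nonempty with h0 | hne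
  · rw [← hI, h0] at hr
    simp at hr
  · refine h I ⟨hne, x, ?_⟩ (by rwa [IsBalanced, hI])
    simp [I]

/-- The map `g : T → S^{d-1}` defined by a subordinate partition of unity. -/
def coverMap (v : Fin m → E d) (r : E d) (F : Fin m → Opens T) (h : NoBalancedSimplex v r F)
    (Φ : PartitionOfUnity (Fin m) T) (hΦ : Φ.IsSubordinate fun i => F i) : C(T, Sph d) :=
  radial r (rho v Φ) fun x hx => h.notMem x (hx ▸ rho_mem v Φ F hΦ x)

theorem exists_partition [T2Space T] [ParacompactSpace T] (F : Fin m → Opens T)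
    (hF : IsOpenCover F) : ∃ Φ : PartitionOfUnity (Fin m) T, Φ.IsSubordinate fun i => F i :=
  PartitionOfUnity.exists_isSubordinate isClosed_univ _ (fun i => (F i).isOpen)
    hF.iSup_set_eq_univ.ge

open Classical in
/-- The homotopy class `[F_(V, r)] ∈ [T, S^{d-1}]` of an open cover; the value `none` stands for
"undefined" and is taken when the nerve has an `r`-balanced simplex. By
`coverClass_eq` below it does not depend on the partition of unity. -/
def coverClass [T2Space T] [ParacompactSpace T] (v : Fin m → E d) (r : E d) (F : Fin m → Opens T)
    (hF : IsOpenCover F) : Option (HomotopyClass T (Sph d)) :=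
  if h : NoBalancedSimplex v r F then
    some (homotopyClass (coverMap v r F h (exists_partition F hF).choose
      (exists_partition F hF).choose_spec))
  else none

theorem coverClass_eq [T2Space T] [ParacompactSpace T] (v : Fin m → E d) (r : E d)
    (F : Fin m → Opens T) (hF : IsOpenCover F) (h : NoBalancedSimplex v r F)
    (Φ : PartitionOfUnity (Fin m) T) (hΦ : Φ.IsSubordinate fun i => F i) :
    coverClass v r F hF = some (homotopyClass (coverMap v r F h Φ hΦ)) := by
  rw [coverClass, dif_pos h]
  refine congrArg some (radial_homotopic _ _ _ _ _ fun x hx => h.notMem x ?_)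
  exact (convex_convexHull ℝ _).segment_subset (rho_mem v _ F (exists_partition F hF).choose_spec x)
    (rho_mem v Φ F hΦ x) hx

/-! ### The homotopy class of a coloring -/

open Classical in
/-- The homotopy class `[L_(V, r)] ∈ [T, S^{d-1}]` of a coloring `L` of the vertices of a
triangulation `K` of `T` by the colors `1, …, m`: the class of the map which sends a vertex `u` to
`v_{L(u)}`, is affine on each simplex, and is followed by the radial projection. The value `none`
stands for "undefined" and is taken when the colors of some simplex form an `r`-balanced set. -/
def colorClass (v : Fin m → E d) (r : E d) (K : Triangulation T) (L : K.Vertex → Fin m) :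
    Option (HomotopyClass T (Sph d)) :=
  if h : ∀ s ∈ K.complex.faces, ¬ IsBalanced v r (s.image L) then
    some (homotopyClass ((sphereMap K.complex.toPreAbstractSimplicialComplex (v ∘ L) r
      fun s hs => by simpa [IsBalanced, ← image_comp] using h s hs).comp
        (K.homeo.symm : C(T, Realization K.complex.toPreAbstractSimplicialComplex))))
  else none

end balanced

end BalancedCover

end

open BalancedCover TopologicalSpace

/-!
Fix a representative `g : T → S^{d-1}` of the homotopy class. A map `f : T → ℝ^d` whose value
`f x` always satisfies `0 < ⟪f x - r, g x⟫` misses `r` and is homotopic to `g` after radial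
projection, by a straight-line homotopy (`homotopyClass_radial_eq`). Both parts produce such a
map.

For the cover, the weights `max 0 ⟪v_i - r, y⟫`, normalized, are the barycentric coordinates of a
point of `|K(V, r)|` which depends continuously on `y ∈ S^{d-1}`: the `v_i` with positive weight
lie in an open half space bounded by a hyperplane through `r`, and there are some because `r` is
an interior point (`exists_sphere_lift`). This map, composed with `g`, is the required `f`, and
any partition of unity subordinate to the pullback of the star cover only uses these `v_i`.

For the coloring, there is `c > 0` such that each `y ∈ S^{d-1}` has some `i` with
`c ≤ ⟪v_i - r, y⟫`. On a triangulation of `T` on whose simplices `g` oscillates little, give the vertex `u` a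
color `i` that belongs to `y = g u`; then `0 < ⟪v_i - r, g x⟫` for all `x` in the simplices that
contain `u`. So it remains to find a fine triangulation (`exists_fine_triangulation`), where the
given complex is arbitrary: it may be infinite, not locally finite, and of infinite dimension, so
that no fixed number of barycentric subdivisions is enough.

The solution is to repeat the barycentric subdivision relative to the subcomplex of those
simplices that are fine already. Simplices that are fine stay forever, and the limit complex
consists of them. It is a subdivision because each closed simplex `C` is subdivided finitely often
only (`exists_forall_mem_fineSets`): otherwise, by König's lemma, there is a sequence of simplices
in `C`, none of them fine, each of which has the preceding one as its carrier. The vertices which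
stay in this sequence forever span a fine simplex `P`. If `P` is not empty, the sequence converges
to `P`, since the barycenter of a simplex that contains `P` is nearer to `P` than its farthest
vertex by a fixed factor; if `P` is empty, the diameters tend to zero. In both cases some simplex
of the sequence is fine, by the uniform continuity of `g` on `C` (`exists_mem_fineSets`).

That a subdivision covers each point just once is a statement about weights (`UniqueWeights`): the
weights of a point with respect to a relative barycentric subdivision are obtained from its
barycentric coordinates by repeatedly subtracting the smallest one (`exists_carrier_of_weight`,
`UniqueWeights.eq_of_carrier`).
-/

namespace BalancedCover

open scoped Classical

/-! ### Barycentric subdivision relative to a subcomplex -/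

section subdivision

variable {W : Type*}

/-- The weight that is `1` on `s` and `0` elsewhere. -/
noncomputable def indicatorWeight (s : Finset W) : W →₀ ℝ := Finsupp.indicator s fun _ _ => 1

theorem indicatorWeight_apply (s : Finset W) (a : W) :
    indicatorWeight s a = if a ∈ s then 1 else 0 := by
  simp [indicatorWeight, Finsupp.indicator_apply]

theorem indicatorWeight_nonneg (s : Finset W) : 0 ≤ indicatorWeight s := by
  intro a
  rw [indicatorWeight_apply]
  split_ifs <;> simp

theorem support_smul_indicatorWeight {c : ℝ} (hc : c ≠ 0) (s : Finset W) :
    (c • indicatorWeight s).support = s := by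
  ext a
  simp [indicatorWeight_apply, hc]

theorem support_add_of_nonneg {t t' : W →₀ ℝ} (h : 0 ≤ t) (h' : 0 ≤ t') :
    (t + t').support = t.support ∪ t'.support := by
  ext a
  have h1 : 0 ≤ t a := h a
  have h2 : 0 ≤ t' a := h' a
  simp only [Finsupp.mem_support_iff, Finsupp.coe_add, Pi.add_apply, ne_eq, Finset.mem_union]
  rw [add_eq_zero_iff_of_nonneg h1 h2]
  tauto

theorem nonneg_erase {t : W →₀ ℝ} (ht : 0 ≤ t) (a : W) : 0 ≤ t.erase a := by
  intro b
  by_cases h : b = a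
  · simp [h]
  · simpa [Finsupp.erase_ne h] using ht b

variable [AddCommGroup W] [Module ℝ W]

/-- The barycenter of a finite set of points. -/
noncomputable def bary (s : Finset W) : W := (s.card : ℝ)⁻¹ • ∑ a ∈ s, a

/-- The point `∑ t_a a` with the weights `t`. -/
noncomputable abbrev lin : (W →₀ ℝ) →ₗ[ℝ] W := Finsupp.linearCombination ℝ id

theorem lin_indicatorWeight (s : Finset W) : lin (indicatorWeight s) = ∑ a ∈ s, a := by
  rw [Finsupp.linearCombination_apply, Finsupp.sum_of_support_subset (s := s)]
  · refine Finset.sum_congr rfl fun a ha => ?_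
    simp [indicatorWeight_apply, ha]
  · intro a ha
    by_contra h
    simp [indicatorWeight_apply, h] at ha
  · simp

theorem lin_smul_indicatorWeight {s : Finset W} (hs : s.Nonempty) (c : ℝ) :
    lin (c • indicatorWeight s) = (c * s.card) • bary s := by
  have : (s.card : ℝ) ≠ 0 := by exact_mod_cast hs.card_pos.ne'
  rw [map_smul, lin_indicatorWeight, bary, smul_smul, mul_assoc, mul_inv_cancel₀ this, mul_one]

theorem lin_single (a : W) (c : ℝ) : lin (Finsupp.single a c) = c • a := by
  simp

/-- `Carrier K F s S` says that `s` is a simplex of the barycentric subdivision of `K` relative to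
its subcomplex `F`, and that `S` is the smallest simplex of `K` that contains `s`. The simplices of
`F` are kept, and the cone from the barycenter of a simplex `S ∉ F` over the subdivided boundary
of `S` is added. -/
inductive Carrier (K F : Set (Finset W)) : Finset W → Finset W → Prop
  | keep {A : Finset W} (hK : A ∈ K) (hF : A ∈ F) : Carrier K F A A
  | cone {s S₀ S : Finset W} (h : Carrier K F s S₀) (hS : S₀ ⊂ S) (hK : S ∈ K) (hF : S ∉ F) :
      Carrier K F (insert (bary S) s) S

/-- The barycentric subdivision of `K` relative to its subcomplex `F`. -/
def subdivision (K F : Set (Finset W)) : Set (Finset W) := {s | ∃ S, Carrier K F s S}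

/-- A point has at most one representation `∑ t_a a` with positive weights on a simplex of `K`. For
simplices in an affine hyperplane that misses the origin, this says that they are affinely
independent and that the interiors of distinct simplices are disjoint. -/
def UniqueWeights (K : Set (Finset W)) : Prop :=
  ∀ ⦃t t' : W →₀ ℝ⦄, 0 ≤ t → 0 ≤ t' → t.support ∈ K → t'.support ∈ K → lin t = lin t' → t = t'

variable {K F : Set (Finset W)} {s S : Finset W}

theorem Carrier.mem (h : Carrier K F s S) : S ∈ K := by
  cases h <;> assumption

theorem Carrier.eq_or_notMem (h : Carrier K F s S) : s = S ∨ S ∉ F := by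
  cases h
  · exact Or.inl rfl
  · exact Or.inr ‹_›

theorem Carrier.exists_of_subset (hK : IsLowerSet K) (hF : IsLowerSet F) (h : Carrier K F s S) :
    ∀ s' ⊆ s, ∃ S' ⊆ S, Carrier K F s' S' := by
  induction h with
  | keep hA hA' => exact fun s' hs' => ⟨s', hs', .keep (hK hs' hA) (hF hs' hA')⟩
  | @cone s S₀ S _ hS hSK hSF ih =>
    intro s' hs'
    obtain ⟨S', hS', h'⟩ := ih (s'.erase (bary S)) (Finset.subset_insert_iff.1 hs')
    by_cases hb : bary S ∈ s'
    · refine ⟨S, subset_rfl, ?_⟩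
      rw [← Finset.insert_erase hb]
      exact .cone h' (lt_of_le_of_lt hS' hS) hSK hSF
    · rw [Finset.erase_eq_of_notMem hb] at h'
      exact ⟨S', hS'.trans hS.1, h'⟩

theorem isLowerSet_subdivision (hK : IsLowerSet K) (hF : IsLowerSet F) :
    IsLowerSet (subdivision K F) := by
  rintro s s' hs' ⟨S, h⟩
  obtain ⟨S', -, h'⟩ := h.exists_of_subset hK hF s' hs'
  exact ⟨S', h'⟩

theorem Carrier.card_le (h : Carrier K F s S) : s.card ≤ S.card := by
  induction h with
  | keep => rfl
  | cone _ hS _ _ ih =>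
    exact (Finset.card_insert_le _ _).trans (ih.trans_lt (Finset.card_lt_card hS))

theorem bary_mem_convexHull {t : Finset W} (ht : t.Nonempty) :
    bary t ∈ convexHull ℝ (t : Set W) := by
  rw [bary, Finset.smul_sum]
  refine (convex_convexHull ℝ _).sum_mem (fun _ _ => by positivity) ?_
    fun a ha => subset_convexHull ℝ _ ha
  have : (t.card : ℝ) ≠ 0 := by exact_mod_cast ht.card_pos.ne'
  simp [this]

theorem Carrier.subset_convexHull (h : Carrier K F s S) :
    (s : Set W) ⊆ convexHull ℝ (S : Set W) := by
  induction h with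
  | keep => exact _root_.subset_convexHull ℝ _
  | @cone s S₀ S _ hS _ _ ih =>
    rw [Finset.coe_insert, Set.insert_subset_iff]
    refine ⟨bary_mem_convexHull ?_, ih.trans (convexHull_mono (Finset.coe_subset.2 hS.1))⟩
    exact Finset.Nonempty.mono (Finset.sdiff_subset (t := S₀)) (Finset.sdiff_nonempty.2 hS.2)

theorem exists_weight_of_mem_convexHull {x : W} (hx : x ∈ convexHull ℝ (S : Set W)) :
    ∃ e : W →₀ ℝ, 0 ≤ e ∧ e.support ⊆ S ∧ lin e = x := by
  obtain ⟨w, hw, -, hx⟩ := Finset.mem_convexHull'.1 hx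
  have key : ∀ a, Finsupp.indicator S (fun a _ => w a) a = if a ∈ S then w a else 0 := by
    simp [Finsupp.indicator_apply]
  refine ⟨Finsupp.indicator S fun a _ => w a, fun a => ?_, Finsupp.support_indicator_subset _ _, ?_⟩
  · rw [key]
    split_ifs with h
    · exact hw a h
    · rfl
  · rw [Finsupp.linearCombination_apply, Finsupp.sum_of_support_subset (s := S) _
      (Finsupp.support_indicator_subset _ _) _ (by simp), ← hx]
    refine Finset.sum_congr rfl fun a ha => ?_
    rw [key, if_pos ha, id]

/-- The barycenter of a simplex does not lie in a proper face. -/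
theorem UniqueWeights.bary_notMem (hU : UniqueWeights K) (hK : IsLowerSet K) (hS : S ∈ K)
    {S₀ : Finset W} (h : S₀ ⊂ S) : bary S ∉ convexHull ℝ (S₀ : Set W) := by
  intro hb
  obtain ⟨e, he, hes, heq⟩ := exists_weight_of_mem_convexHull hb
  have hne : S.Nonempty :=
    Finset.Nonempty.mono (Finset.sdiff_subset (t := S₀)) (Finset.sdiff_nonempty.2 h.2)
  have hc : (S.card : ℝ)⁻¹ ≠ 0 := inv_ne_zero (by exact_mod_cast hne.card_pos.ne')
  have hc' : (0 : ℝ) ≤ (S.card : ℝ)⁻¹ := by positivity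
  have := hU (t := (S.card : ℝ)⁻¹ • indicatorWeight S) (t' := e)
    (smul_nonneg hc' (indicatorWeight_nonneg S)) he
    (by rwa [support_smul_indicatorWeight hc]) (hK (hes.trans h.1) hS) (by
      rw [lin_smul_indicatorWeight hne, inv_mul_cancel₀ (by simpa using hc), one_smul, heq])
  have h2 := congrArg Finsupp.support this
  rw [support_smul_indicatorWeight hc] at h2
  exact h.2 (h2 ▸ hes)

/-- A simplex of the subdivision, other than the kept ones, is a cone over a simplex of the
subdivided boundary of its carrier. -/
theorem Carrier.exists_erase (hU : UniqueWeights K) (hK : IsLowerSet K) (h : Carrier K F s S)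
    (hS : S ∉ F) :
    bary S ∈ s ∧ ∃ S₀ ⊂ S, Carrier K F (s.erase (bary S)) S₀ := by
  cases h with
  | keep _ hF => exact absurd hF hS
  | @cone s S₀ S h hS hSK hSF =>
    refine ⟨Finset.mem_insert_self _ _, S₀, hS, ?_⟩
    rwa [Finset.erase_insert]
    exact fun hb => hU.bary_notMem hK hSK hS (h.subset_convexHull hb)

/-- Weights on a simplex of the subdivision are turned into weights on its carrier. -/
theorem Carrier.exists_weight (hU : UniqueWeights K) (hK : IsLowerSet K) (h : Carrier K F s S) :
    ∀ t : W →₀ ℝ, 0 ≤ t → t.support = s → ∃ e : W →₀ ℝ, 0 ≤ e ∧ e.support = S ∧ lin e = lin t := by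
  induction h with
  | keep => exact fun t h0 h1 => ⟨t, h0, h1, rfl⟩
  | @cone s S₀ S h hS hSK hSF ih =>
    intro t h0 h1
    have hb : bary S ∉ s := fun hb => hU.bary_notMem hK hSK hS (h.subset_convexHull hb)
    have hne : S.Nonempty :=
      Finset.Nonempty.mono (Finset.sdiff_subset (t := S₀)) (Finset.sdiff_nonempty.2 hS.2)
    have hc : (S.card : ℝ) ≠ 0 := by exact_mod_cast hne.card_pos.ne'
    obtain ⟨e, he0, he1, he2⟩ := ih (t.erase (bary S)) (nonneg_erase h0 _)
      (by rw [Finsupp.support_erase, h1, Finset.erase_insert hb])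
    have hpos : t (bary S) ≠ 0 := by
      rw [← Finsupp.mem_support_iff, h1]
      exact Finset.mem_insert_self _ _
    have hnn : 0 ≤ t (bary S) / S.card := div_nonneg (h0 _) (Nat.cast_nonneg _)
    have hI : 0 ≤ (t (bary S) / S.card) • indicatorWeight S :=
      smul_nonneg hnn (indicatorWeight_nonneg S)
    refine ⟨(t (bary S) / S.card) • indicatorWeight S + e, add_nonneg hI he0, ?_, ?_⟩
    · rw [support_add_of_nonneg hI he0, support_smul_indicatorWeight (div_ne_zero hpos hc), he1,
        Finset.union_eq_left]
      exact hS.1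
    · rw [map_add, lin_smul_indicatorWeight hne, he2, div_mul_cancel₀ _ hc, ← lin_single,
        ← map_add, Finsupp.single_add_erase]

/-- The coordinates of a point with respect to the subdivision are found by subtracting the
smallest coordinate from all coordinates, for as long as the support is not in `F`. -/
theorem exists_carrier_of_weight (hK : IsLowerSet K) (hF : ∅ ∈ F) (e : W →₀ ℝ) (he : 0 ≤ e)
    (heK : e.support ∈ K) :
    ∃ t : W →₀ ℝ, 0 ≤ t ∧ Carrier K F t.support e.support ∧ lin t = lin e := by
  induction hn : e.support.card using Nat.strong_induction_on generalizing e with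
  | _ n ih =>
  by_cases hf : e.support ∈ F
  · exact ⟨e, he, .keep heK hf, rfl⟩
  have hne : e.support.Nonempty := by
    by_contra h
    rw [Finset.not_nonempty_iff_eq_empty] at h
    exact hf (h ▸ hF)
  obtain ⟨a, ha, hmin⟩ := e.support.exists_min_image e hne
  have hapos : 0 < e a := lt_of_le_of_ne (he a) (Ne.symm (Finsupp.mem_support_iff.1 ha))
  have hcard : (0 : ℝ) < e.support.card := by exact_mod_cast hne.card_pos
  set e₀ := e - e a • indicatorWeight e.support with he₀
  have happ : ∀ b, e₀ b = e b - e a * if b ∈ e.support then 1 else 0 := by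
    intro b
    simp [he₀, indicatorWeight_apply]
  have h0 : 0 ≤ e₀ := by
    intro b
    rw [happ]
    split_ifs with hb
    · simpa using hmin b hb
    · simpa using he b
  have hsub : e₀.support ⊆ e.support := by
    intro b hb
    by_contra hb'
    rw [Finsupp.mem_support_iff, happ, if_neg hb', Finsupp.notMem_support_iff.1 hb'] at hb
    simp at hb
  have hss : e₀.support ⊂ e.support := by
    refine ⟨hsub, fun h => ?_⟩
    have := h ha
    rw [Finsupp.mem_support_iff, happ, if_pos ha] at this
    simp at this
  obtain ⟨t, ht0, ht, hlin⟩ := ih _ (hn ▸ Finset.card_lt_card hss) e₀ h0 (hK hsub heK) rfl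
  have hs0 : 0 ≤ Finsupp.single (bary e.support) (e a * e.support.card) :=
    Finsupp.single_nonneg.2 (by positivity)
  refine ⟨Finsupp.single (bary e.support) (e a * e.support.card) + t, add_nonneg hs0 ht0, ?_, ?_⟩
  · rw [support_add_of_nonneg hs0 ht0, Finsupp.support_single _ (by positivity)]
    exact .cone ht hss heK hf
  · rw [map_add, hlin, lin_single, ← lin_smul_indicatorWeight hne, ← map_add, he₀,
      add_sub_cancel]

theorem UniqueWeights.eq_of_carrier (hU : UniqueWeights K) (hK : IsLowerSet K)
    {t t' : W →₀ ℝ} (h0 : 0 ≤ t) (h0' : 0 ≤ t') {S' : Finset W} (h : Carrier K F t.support S)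
    (h' : Carrier K F t'.support S') (hlin : lin t = lin t') : t = t' := by
  induction hn : S.card using Nat.strong_induction_on generalizing S S' t t' with
  | _ n ih =>
  obtain ⟨e, he0, he1, he2⟩ := h.exists_weight hU hK t h0 rfl
  obtain ⟨e', he0', he1', he2'⟩ := h'.exists_weight hU hK t' h0' rfl
  have hSS : S = S' := by
    rw [← he1, ← he1', hU he0 he0' (he1 ▸ h.mem) (he1' ▸ h'.mem) (by rw [he2, he2', hlin])]
  subst hSS
  by_cases hF : S ∈ F
  · have h1 := h.eq_or_notMem.resolve_right (not_not.2 hF)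
    have h1' := h'.eq_or_notMem.resolve_right (not_not.2 hF)
    exact hU h0 h0' (h1 ▸ h.mem) (h1' ▸ h.mem) hlin
  obtain ⟨hb, S₀, hS₀, hc⟩ := h.exists_erase hU hK hF
  obtain ⟨hb', S₀', hS₀', hc'⟩ := h'.exists_erase hU hK hF
  rw [← Finsupp.support_erase] at hc hc'
  have hne : S.Nonempty :=
    Finset.Nonempty.mono (Finset.sdiff_subset (t := S₀)) (Finset.sdiff_nonempty.2 hS₀.2)
  have hcard : (0 : ℝ) < S.card := by exact_mod_cast hne.card_pos
  obtain ⟨f, hf0, hf1, hf2⟩ := hc.exists_weight hU hK _ (nonneg_erase h0 _) rfl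
  obtain ⟨f', hf0', hf1', hf2'⟩ := hc'.exists_weight hU hK _ (nonneg_erase h0' _) rfl
  -- The weights of the barycenter agree, as each is `|S|` times the smallest weight on `S`.
  have expand : ∀ {u : W →₀ ℝ}, 0 ≤ u → bary S ∈ u.support → ∀ {g : W →₀ ℝ}, 0 ≤ g →
      ∀ {T : Finset W}, T ⊂ S → g.support = T → lin g = lin (u.erase (bary S)) →
      let q := (u (bary S) / S.card) • indicatorWeight S + g
      0 ≤ q ∧ q.support = S ∧ lin q = lin u := by
    intro u hu hbu g hg T hT hgT hgl
    have hnn : 0 ≤ u (bary S) / S.card := div_nonneg (hu _) hcard.le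
    have hI : 0 ≤ (u (bary S) / S.card) • indicatorWeight S :=
      smul_nonneg hnn (indicatorWeight_nonneg S)
    refine ⟨add_nonneg hI hg, ?_, ?_⟩
    · rw [support_add_of_nonneg hI hg, support_smul_indicatorWeight
        (div_ne_zero (Finsupp.mem_support_iff.1 hbu) hcard.ne'), hgT, Finset.union_eq_left]
      exact hT.1
    · rw [map_add, lin_smul_indicatorWeight hne, hgl, div_mul_cancel₀ _ hcard.ne', ← lin_single,
        ← map_add, Finsupp.single_add_erase]
  obtain ⟨q0, q1, q2⟩ := expand h0 hb hf0 hS₀ hf1 hf2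
  obtain ⟨q0', q1', q2'⟩ := expand h0' hb' hf0' hS₀' hf1' hf2'
  have hq := hU q0 q0' (by rw [q1]; exact h.mem) (by rw [q1']; exact h.mem) (by rw [q2, q2', hlin])
  have hγ : t (bary S) = t' (bary S) := by
    obtain ⟨a, ha⟩ := Finset.sdiff_nonempty.2 hS₀.2
    obtain ⟨a', ha'⟩ := Finset.sdiff_nonempty.2 hS₀'.2
    rw [Finset.mem_sdiff] at ha ha'
    have e1 := DFunLike.congr_fun hq a
    have e2 := DFunLike.congr_fun hq a'
    have z1 : f a = 0 := Finsupp.notMem_support_iff.1 (hf1 ▸ ha.2)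
    have z2 : f' a' = 0 := Finsupp.notMem_support_iff.1 (hf1' ▸ ha'.2)
    have n1 : 0 ≤ f' a := hf0' a
    have n2 : 0 ≤ f a' := hf0 a'
    simp only [Finsupp.coe_add, Finsupp.coe_smul, Pi.add_apply, Pi.smul_apply,
      indicatorWeight_apply, ha.1, ha'.1, if_true, smul_eq_mul, mul_one, z1, z2] at e1 e2
    have : t (bary S) / S.card = t' (bary S) / S.card := by linarith
    exact (div_left_inj' hcard.ne').1 this
  have hrec := ih _ (hn ▸ Finset.card_lt_card hS₀) (nonneg_erase h0 (bary S))
    (nonneg_erase h0' (bary S)) hc hc' (by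
      have e1 := congrArg lin (Finsupp.single_add_erase (bary S) t)
      have e2 := congrArg lin (Finsupp.single_add_erase (bary S) t')
      rw [map_add] at e1 e2
      rw [hlin, ← e2, hγ] at e1
      exact add_left_cancel e1) rfl
  rw [← Finsupp.single_add_erase (bary S) t, ← Finsupp.single_add_erase (bary S) t', hγ, hrec]

theorem UniqueWeights.subdivision (hU : UniqueWeights K) (hK : IsLowerSet K) :
    UniqueWeights (subdivision K F) := by
  rintro t t' h0 h0' ⟨S, h⟩ ⟨S', h'⟩ hlin
  exact hU.eq_of_carrier hK h0 h0' h h' hlin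

/-- A vertex of a simplex that lies in a face of it is a vertex of that face. -/
theorem UniqueWeights.mem_of_mem_convexHull (hU : UniqueWeights K) (hK : IsLowerSet K)
    (hS : S ∈ K) {S₀ : Finset W} (h : S₀ ⊆ S) {a : W} (ha : a ∈ S)
    (hb : a ∈ convexHull ℝ (S₀ : Set W)) : a ∈ S₀ := by
  obtain ⟨e, he, hes, heq⟩ := exists_weight_of_mem_convexHull hb
  have hsupp : (Finsupp.single a (1 : ℝ)).support = {a} := Finsupp.support_single _ one_ne_zero
  have := hU (t := Finsupp.single a 1) (t' := e) (Finsupp.single_nonneg.2 zero_le_one) he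
    (by rw [hsupp]; exact hK (Finset.singleton_subset_iff.2 ha) hS) (hK (hes.trans h) hS)
    (by rw [lin_single, one_smul, heq])
  rw [← this, hsupp, Finset.singleton_subset_iff] at hes
  exact hes

/-- How a simplex `s` of the subdivision lies in its carrier `S`: the common vertices span a simplex
of `F`; the other vertices of `s` are barycenters of simplices that contain the common vertices;
and of two vertices that are not both common, one is the barycenter of a simplex that contains the
other. -/
theorem Carrier.vertices (hU : UniqueWeights K) (hK : IsLowerSet K)
    (hF : ∀ a, {a} ∈ F) (h : Carrier K F s S) :
    s ∩ S ∈ F ∧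
    (∀ a ∈ s, a ∉ S → ∃ t : Finset W, s ∩ S ⊆ t ∧ t ⊆ S ∧ t.Nonempty ∧ a = bary t) ∧
    ∀ a ∈ s, ∀ b ∈ s, ¬ (a ∈ S ∧ b ∈ S) → ∃ t : Finset W, t ⊆ S ∧ t.Nonempty ∧
      (a = bary t ∧ b ∈ convexHull ℝ (t : Set W) ∨ b = bary t ∧ a ∈ convexHull ℝ (t : Set W)) := by
  induction h with
  | keep _ hAF =>
    refine ⟨by rwa [Finset.inter_self], fun a ha ha' => absurd ha ha', ?_⟩
    exact fun a ha b hb hab => absurd ⟨ha, hb⟩ hab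
  | @cone s S₀ S h hS hSK hSF ih =>
    have hne : S.Nonempty :=
      Finset.Nonempty.mono (Finset.sdiff_subset (t := S₀)) (Finset.sdiff_nonempty.2 hS.2)
    have hbS : bary S ∉ S := by
      intro hb
      have hs : {bary S} ⊆ S := Finset.singleton_subset_iff.2 hb
      refine hU.bary_notMem hK hSK (S₀ := {bary S}) (hs.ssubset_of_ne fun he => ?_)
        (by simp)
      exact hSF (he ▸ hF _)
    have hmem : ∀ a ∈ s, a ∈ S → a ∈ S₀ := fun a ha haS =>
      hU.mem_of_mem_convexHull hK hSK hS.1 haS (h.subset_convexHull ha)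
    have hinter : insert (bary S) s ∩ S = s ∩ S₀ := by
      ext a
      simp only [Finset.mem_inter, Finset.mem_insert]
      constructor
      · rintro ⟨rfl | ha, haS⟩
        · exact absurd haS hbS
        · exact ⟨ha, hmem a ha haS⟩
      · exact fun ⟨ha, haS⟩ => ⟨Or.inr ha, hS.1 haS⟩
    have hconv : ∀ b ∈ insert (bary S) s, b ∈ convexHull ℝ (S : Set W) := fun b hb =>
      (Carrier.cone h hS hSK hSF).subset_convexHull hb
    obtain ⟨ih1, ih2, ih3⟩ := ih
    rw [hinter]
    refine ⟨ih1, fun a ha haS => ?_, fun a ha b hb hab => ?_⟩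
    · rcases Finset.mem_insert.1 ha with rfl | ha
      · exact ⟨S, Finset.inter_subset_right.trans hS.1, subset_rfl, hne, rfl⟩
      · obtain ⟨t, h1, h2, h3⟩ := ih2 a ha fun h => haS (hS.1 h)
        exact ⟨t, h1, h2.trans hS.1, h3⟩
    · rcases Finset.mem_insert.1 ha with rfl | ha'
      · exact ⟨S, subset_rfl, hne, Or.inl ⟨rfl, hconv b hb⟩⟩
      rcases Finset.mem_insert.1 hb with rfl | hb'
      · exact ⟨S, subset_rfl, hne, Or.inr ⟨rfl, hconv a ha⟩⟩
      obtain ⟨t, h1, h2⟩ := ih3 a ha' b hb' fun h => hab ⟨hS.1 h.1, hS.1 h.2⟩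
      exact ⟨t, h1.trans hS.1, h2⟩

end subdivision

/-! ### Descending sequences of simplices -/

section termination

/-- Let `R x ρ` say that `x` has size at most `ρ`. If, in a sequence of finite sets, the elements
that join are smaller by the factor `κ < 1` than the largest element before, and if the elements
that stay forever have size `0`, then the sizes of all elements tend to `0`. -/
theorem exists_forall_size_le {X : Type*} (O : ℕ → Set X) (hO : ∀ n, (O n).Finite)
    (R : X → ℝ → Prop) (hmono : ∀ x a b, a ≤ b → R x a → R x b) (hex : ∀ n, ∀ x ∈ O n, ∃ a, R x a)
    {κ : ℝ} (hκ0 : 0 ≤ κ) (hκ1 : κ < 1)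
    (hnew : ∀ n ρ, 0 ≤ ρ → (∀ x ∈ O n, R x ρ) → ∀ x ∈ O (n + 1), x ∉ O n → R x (κ * ρ))
    (hstay : ∀ n x, (∀ k ≥ n, x ∈ O k) → R x 0) {δ : ℝ} (hδ : 0 < δ) :
    ∃ n, ∀ x ∈ O n, R x δ := by
  have step : ∀ n ρ, 0 ≤ ρ → (∀ x ∈ O n, R x ρ) → ∃ n', ∀ x ∈ O n', R x (κ * ρ) := by
    intro n ρ hρ h
    have hκρ : κ * ρ ≤ ρ := mul_le_of_le_one_left hρ hκ1.le
    have all : ∀ m, n ≤ m → ∀ x ∈ O m, R x ρ := by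
      intro m hm
      induction m, hm using Nat.le_induction with
      | base => exact h
      | succ m hm ih =>
        intro x hx
        by_cases hxm : x ∈ O m
        · exact ih x hxm
        · exact hmono x _ _ hκρ (hnew m ρ hρ ih x hx hxm)
    have old : ∀ m, n ≤ m → ∀ x ∈ O m, R x (κ * ρ) ∨ ∀ k, n ≤ k → k ≤ m → x ∈ O k := by
      intro m hm
      induction m, hm using Nat.le_induction with
      | base =>
        intro x hx
        refine Or.inr fun k h1 h2 => ?_
        rwa [le_antisymm h2 h1]
      | succ m hm ih =>
        intro x hx
        by_cases hxm : x ∈ O m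
        · refine (ih x hxm).imp_right fun h k h1 h2 => ?_
          rcases Nat.le_succ_iff.1 h2 with h2 | rfl
          · exact h k h1 h2
          · exact hx
        · exact Or.inl (hnew m ρ hρ (all m hm) x hx hxm)
    have gone : ∀ᶠ m in Filter.atTop, ∀ x ∈ O n, R x 0 ∨ ∃ k, n ≤ k ∧ k ≤ m ∧ x ∉ O k := by
      rw [Filter.eventually_all_finite (hO n)]
      intro x _
      by_cases hx : ∀ k ≥ n, x ∈ O k
      · exact Filter.Eventually.of_forall fun _ => Or.inl (hstay n x hx)
      · push Not at hx
        obtain ⟨k, hk, hxk⟩ := hx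
        filter_upwards [Filter.eventually_ge_atTop k] with m hm
        exact Or.inr ⟨k, hk, hm, hxk⟩
    obtain ⟨m, hm, hnm⟩ := (gone.and (Filter.eventually_ge_atTop n)).exists
    refine ⟨m, fun x hx => (old m hnm x hx).elim id fun hall => ?_⟩
    rcases hm x (hall n le_rfl hnm) with h0 | ⟨k, h1, h2, h3⟩
    · exact hmono x _ _ (mul_nonneg hκ0 hρ) h0
    · exact absurd (hall k h1 h2) h3
  obtain ⟨ρ, hρ0, hρ⟩ : ∃ ρ, 0 ≤ ρ ∧ ∀ x ∈ O 0, R x ρ := by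
    choose! a ha using hex 0
    obtain ⟨b, hb⟩ := ((hO 0).image a).bddAbove
    exact ⟨max b 0, le_max_right _ _, fun x hx => hmono x _ _
      ((hb (mem_image_of_mem a hx)).trans (le_max_left _ _)) (ha x hx)⟩
  have pow : ∀ j : ℕ, ∃ n, ∀ x ∈ O n, R x (κ ^ j * ρ) := by
    intro j
    induction j with
    | zero => exact ⟨0, by simpa using hρ⟩
    | succ j ih =>
      obtain ⟨n, hn⟩ := ih
      obtain ⟨n', hn'⟩ := step n _ (by positivity) hn
      exact ⟨n', by simpa only [pow_succ', mul_assoc] using hn'⟩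
  have hlim : Filter.Tendsto (fun j : ℕ => κ ^ j * ρ) Filter.atTop (nhds 0) := by
    simpa using (tendsto_pow_atTop_nhds_zero_of_lt_one hκ0 hκ1).mul_const ρ
  obtain ⟨j, hj⟩ := (hlim.eventually_lt_const hδ).exists
  obtain ⟨n, hn⟩ := pow j
  exact ⟨n, fun x hx => hmono x _ _ hj.le (hn x hx)⟩

variable {W : Type*} [AddCommGroup W] [Module ℝ W]

/-- The finite sets of points on whose convex hull `G` oscillates by less than `ε`. -/
def fineSets {Y : Type*} [PseudoMetricSpace Y] (G : W → Y) (ε : ℝ) : Set (Finset W) :=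
  {s | ∃ ε' < ε, ∀ x ∈ convexHull ℝ (s : Set W), ∀ y ∈ convexHull ℝ (s : Set W),
    dist (G x) (G y) ≤ ε'}

section fineSets

variable {Y : Type*} [PseudoMetricSpace Y] {G : W → Y} {ε : ℝ}

theorem isLowerSet_fineSets : IsLowerSet (fineSets G ε) := by
  rintro s t hts ⟨ε', h, hs⟩
  have := convexHull_mono (𝕜 := ℝ) (Finset.coe_subset.2 hts)
  exact ⟨ε', h, fun x hx y hy => hs x (this hx) y (this hy)⟩

theorem singleton_mem_fineSets (hε : 0 < ε) (a : W) : {a} ∈ fineSets G ε :=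
  ⟨0, hε, fun x hx y hy => by
    rw [Finset.coe_singleton, convexHull_singleton, Set.mem_singleton_iff] at hx hy
    simp [hx, hy]⟩

theorem empty_mem_fineSets (hε : 0 < ε) : ∅ ∈ fineSets G ε :=
  isLowerSet_fineSets (Finset.empty_subset {(0 : W)}) (singleton_mem_fineSets hε 0)

end fineSets

/-- The union of the sets of vertices that stay forever in a sequence of simplices stabilizes. -/
theorem exists_persistent {W : Type*} (s : ℕ → Finset W)
    (hcard : ∀ n, (s (n + 1)).card ≤ (s n).card) :
    ∃ (n₀ : ℕ) (P : Finset W), (∀ n ≥ n₀, P ⊆ s n) ∧ ∀ n a, (∀ k ≥ n, a ∈ s k) → a ∈ P := by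
  have hanti : Antitone fun n => (s n).card := antitone_nat_of_succ_le hcard
  let P : ℕ → Finset W := fun n => (s n).filter fun a => ∀ k ≥ n, a ∈ s k
  have hP : ∀ n a, a ∈ P n ↔ ∀ k ≥ n, a ∈ s k := fun n a => by
    simp only [P, Finset.mem_filter, and_iff_right_iff_imp]
    exact fun h => h n le_rfl
  have hmono : ∀ m n, m ≤ n → P m ⊆ P n := fun m n hmn a ha =>
    (hP n a).2 fun k hk => (hP m a).1 ha k (hmn.trans hk)
  have hbdd : BddAbove (range fun n => (P n).card) := by
    refine ⟨(s 0).card, ?_⟩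
    rintro _ ⟨n, rfl⟩
    exact (Finset.card_le_card (Finset.filter_subset _ _)).trans (hanti (Nat.zero_le n))
  obtain ⟨n₀, hn₀⟩ := Nat.sSup_mem (range_nonempty _) hbdd
  refine ⟨n₀, P n₀, fun n hn a ha => (hP n₀ a).1 ha n hn, fun n a ha => ?_⟩
  have h1 : P n₀ = P (max n₀ n) := Finset.eq_of_subset_of_card_le (hmono _ _ (le_max_left _ _))
    ((le_csSup hbdd (mem_range_self _)).trans_eq hn₀.symm)
  rw [h1]
  exact hmono _ _ (le_max_right _ _) ((hP n a).2 ha)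

theorem one_sub_inv_le {k D : ℕ} (hk : 0 < k) (hkD : k ≤ D) :
    ((k : ℝ) - 1) / k ≤ 1 - (D : ℝ)⁻¹ := by
  have hk' : (0 : ℝ) < k := by exact_mod_cast hk
  rw [sub_div, div_self hk'.ne', one_div]
  have : (D : ℝ)⁻¹ ≤ (k : ℝ)⁻¹ := inv_anti₀ hk' (by exact_mod_cast hkD)
  linarith

theorem bary_sub (t : Finset W) (f : W → W) :
    bary t - (t.card : ℝ)⁻¹ • ∑ a ∈ t, f a = (t.card : ℝ)⁻¹ • ∑ a ∈ t, (a - f a) := by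
  rw [bary, ← smul_sub, Finset.sum_sub_distrib]

/-- A mean of `k` numbers in `[0, ρ]`, one of which is `0`, is at most `(k - 1) / k * ρ`. -/
theorem seminorm_mean_le (p : Seminorm ℝ W) {t : Finset W} {f : W → W} {ρ : ℝ} {a₀ : W}
    (ha₀ : a₀ ∈ t) (h₀ : p (f a₀) = 0) (h : ∀ a ∈ t, p (f a) ≤ ρ) :
    p ((t.card : ℝ)⁻¹ • ∑ a ∈ t, f a) ≤ ((t.card : ℝ) - 1) / t.card * ρ := by
  have hpos : 0 < t.card := Finset.card_pos.2 ⟨a₀, ha₀⟩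
  have hpos' : (0 : ℝ) < t.card := by exact_mod_cast hpos
  have hsum : p (∑ a ∈ t, f a) ≤ ((t.card : ℝ) - 1) * ρ := by
    refine (Finset.le_sum_of_subadditive p (map_zero p).le (map_add_le_add p) t f).trans ?_
    rw [← Finset.add_sum_erase t _ ha₀, h₀, zero_add]
    refine (Finset.sum_le_card_nsmul _ _ ρ fun a ha => h a (Finset.mem_of_mem_erase ha)).trans ?_
    rw [Finset.card_erase_of_mem ha₀, nsmul_eq_mul, Nat.cast_pred hpos]
  rw [map_smul_eq_mul, norm_inv, Real.norm_natCast, div_mul_eq_mul_div, inv_mul_eq_div]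
  gcongr

/-- If each simplex of a sequence lies in the preceding one in the way in which the simplices of a
relative barycentric subdivision lie in their carriers, then one of the simplices is fine. Indeed,
the vertices that stay forever span a fine simplex. If there are any, then each new vertex is closer
to this simplex by a fixed factor, and the sequence converges to it. Otherwise the lengths of the
edges tend to zero. -/
theorem exists_mem_fineSets {Y : Type*} [PseudoMetricSpace Y] {G : W → Y} {ε : ℝ} (hε : 0 < ε)
    (p : Seminorm ℝ W) {C : Set W} (hC : Convex ℝ C)
    (hG : ∀ η > 0, ∃ δ > 0, ∀ x ∈ C, ∀ y ∈ C, p (x - y) ≤ δ → dist (G x) (G y) ≤ η)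
    (s : ℕ → Finset W) (hsC : ∀ n, (s n : Set W) ⊆ C)
    (hcard : ∀ n, (s (n + 1)).card ≤ (s n).card)
    (hfine : ∀ n, s (n + 1) ∩ s n ∈ fineSets G ε)
    (hvert : ∀ n, ∀ a ∈ s (n + 1), a ∉ s n →
      ∃ t : Finset W, s (n + 1) ∩ s n ⊆ t ∧ t ⊆ s n ∧ t.Nonempty ∧ a = bary t)
    (hedge : ∀ n, ∀ a ∈ s (n + 1), ∀ b ∈ s (n + 1), ¬ (a ∈ s n ∧ b ∈ s n) →
      ∃ t : Finset W, t ⊆ s n ∧ t.Nonempty ∧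
        (a = bary t ∧ b ∈ convexHull ℝ (t : Set W) ∨
          b = bary t ∧ a ∈ convexHull ℝ (t : Set W))) :
    ∃ n, s n ∈ fineSets G ε := by
  have hanti : Antitone fun n => (s n).card := antitone_nat_of_succ_le hcard
  obtain ⟨n₀, P, hP, hstay⟩ := exists_persistent s hcard
  set D := (s 0).card + 1 with hD
  have hD0 : (0 : ℝ) < D := by positivity
  have hD1 : (1 : ℝ) ≤ D := by exact_mod_cast Nat.le_add_left 1 _
  have hcardD : ∀ n, ∀ t ⊆ s n, t.card ≤ D := fun n t ht =>
    (Finset.card_le_card ht).trans ((hanti (Nat.zero_le n)).trans (Nat.le_succ _))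
  have hκ0 : 0 ≤ 1 - (D : ℝ)⁻¹ := sub_nonneg.2 (inv_le_one_of_one_le₀ hD1)
  have hκ1 : 1 - (D : ℝ)⁻¹ < 1 := sub_lt_self _ (inv_pos.2 hD0)
  have hconvC : ∀ n, convexHull ℝ (s n : Set W) ⊆ C := fun n => convexHull_min (hsC n) hC
  rcases P.eq_empty_or_nonempty with hPe | hPne
  · obtain ⟨δ, hδ, hGδ⟩ := hG (ε / 2) (half_pos hε)
    obtain ⟨n, hn⟩ := exists_forall_size_le (fun n => (s n : Set W) ×ˢ (s n : Set W))
      (fun n => (s n).finite_toSet.prod (s n).finite_toSet) (fun x ρ => p (x.1 - x.2) ≤ ρ)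
      (fun x a b hab h => h.trans hab) (fun n x _ => ⟨_, le_rfl⟩) hκ0 hκ1 (by
        rintro n ρ hρ hall ⟨a, b⟩ ⟨ha, hb⟩ hab
        have key : ∀ t ⊆ s n, t.Nonempty → ∀ y ∈ convexHull ℝ (t : Set W),
            p (y - bary t) ≤ (1 - (D : ℝ)⁻¹) * ρ := by
          intro t hts ht y hy
          have hsub : (t : Set W) ⊆ p.closedBall (bary t) ((1 - (D : ℝ)⁻¹) * ρ) := by
            intro w hw
            rw [Seminorm.mem_closedBall, map_sub_rev]
            have hw' : w = (t.card : ℝ)⁻¹ • ∑ _a ∈ t, w := by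
              have : (t.card : ℝ) ≠ 0 := by exact_mod_cast ht.card_pos.ne'
              rw [Finset.sum_const, ← Nat.cast_smul_eq_nsmul ℝ, smul_smul, inv_mul_cancel₀ this,
                one_smul]
            have := bary_sub t fun _ => w
            rw [← hw'] at this
            rw [this]
            refine (seminorm_mean_le p (ρ := ρ) hw (by simp) fun u hu =>
              hall (u, w) ⟨hts hu, hts hw⟩).trans ?_
            exact mul_le_mul_of_nonneg_right (one_sub_inv_le ht.card_pos (hcardD n t hts)) hρ
          exact (Seminorm.mem_closedBall p).1 (convexHull_min hsub (p.convex_closedBall _ _) hy)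
        obtain ⟨t, hts, ht, ⟨rfl, h⟩ | ⟨rfl, h⟩⟩ := hedge n a ha b hb hab
        · simpa only [map_sub_rev] using key t hts ht _ h
        · exact key t hts ht _ h) (by
        rintro n ⟨a, b⟩ hab
        have := hstay n a fun k hk => (hab k hk).1
        simp [hPe] at this) hδ
    refine ⟨n, ε / 2, half_lt_self hε, fun x hx y hy =>
      hGδ x (hconvC n hx) y (hconvC n hy) ?_⟩
    -- The bound on the edges extends to the simplex, one endpoint at a time.
    have h1 : ∀ a ∈ s n, y ∈ p.closedBall a δ := fun a ha =>
      convexHull_min (fun b hb => by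
        rw [Seminorm.mem_closedBall]
        exact hn (b, a) ⟨hb, ha⟩) (p.convex_closedBall _ _) hy
    exact (Seminorm.mem_closedBall p).1 (convexHull_min (fun a ha => by
        rw [Seminorm.mem_closedBall, map_sub_rev]
        exact (Seminorm.mem_closedBall p).1 (h1 a ha)) (p.convex_closedBall _ _) hx)
  · have hPfine : P ∈ fineSets G ε := isLowerSet_fineSets
      (Finset.subset_inter (hP _ (Nat.le_succ n₀)) (hP _ le_rfl)) (hfine n₀)
    obtain ⟨ε', hε', hGP⟩ := hPfine
    obtain ⟨δ, hδ, hGδ⟩ := hG ((ε - ε') / 4) (by linarith)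
    obtain ⟨n, hn⟩ := exists_forall_size_le (fun n => (s (n₀ + n) : Set W))
      (fun n => (s _).finite_toSet) (fun x ρ => ∃ y ∈ convexHull ℝ (P : Set W), p (x - y) ≤ ρ)
      (fun x a b hab ⟨y, hy, h⟩ => ⟨y, hy, h.trans hab⟩)
      (fun n x _ => let ⟨y, hy⟩ := hPne; ⟨_, y, subset_convexHull ℝ _ hy, le_rfl⟩) hκ0 hκ1 (by
        intro n ρ hρ hall x hx hxn
        obtain ⟨t, hPt, hts, ht, rfl⟩ := hvert (n₀ + n) x hx hxn
        replace hPt : P ⊆ t := (Finset.subset_inter (hP _ (by omega)) (hP _ (by omega))).trans hPt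
        obtain ⟨a₀, ha₀⟩ := hPne
        choose! f hf hfρ using hall
        let f' : W → W := Function.update f a₀ a₀
        have hf' : ∀ a ∈ t, f' a ∈ convexHull ℝ (P : Set W) ∧ p (a - f' a) ≤ ρ := by
          intro a ha
          by_cases haa : a = a₀
          · subst haa
            simpa [f', hρ] using subset_convexHull ℝ _ ha₀
          · simp only [f', Function.update_of_ne haa]
            exact ⟨hf a (hts ha), hfρ a (hts ha)⟩
        have hcard0 : (t.card : ℝ) ≠ 0 := by exact_mod_cast ht.card_pos.ne'
        refine ⟨(t.card : ℝ)⁻¹ • ∑ a ∈ t, f' a, ?_, ?_⟩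
        · rw [Finset.smul_sum]
          refine (convex_convexHull ℝ _).sum_mem (fun _ _ => by positivity) ?_
            fun a ha => (hf' a ha).1
          simp [hcard0]
        · rw [bary_sub]
          refine (seminorm_mean_le p (ρ := ρ) (hPt ha₀) (by simp [f']) fun u hu =>
            (hf' u hu).2).trans ?_
          exact mul_le_mul_of_nonneg_right (one_sub_inv_le ht.card_pos (hcardD _ t hts)) hρ) (by
        intro n x hx
        refine ⟨x, subset_convexHull ℝ _ (hstay (n₀ + n) x fun k hk => ?_), by simp⟩
        obtain ⟨j, rfl⟩ := Nat.exists_eq_add_of_le hk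
        simpa only [add_assoc, Finset.mem_coe] using hx (n + j) (by omega)) hδ
    refine ⟨n₀ + n, ε' + (ε - ε') / 2, by linarith, ?_⟩
    have hnear : ∀ x ∈ convexHull ℝ (s (n₀ + n) : Set W),
        ∃ y ∈ convexHull ℝ (P : Set W), p (x - y) ≤ δ := by
      have hconv : Convex ℝ {x | ∃ y ∈ convexHull ℝ (P : Set W), p (x - y) ≤ δ} := by
        rintro x ⟨y, hy, hxy⟩ x' ⟨y', hy', hxy'⟩ a b ha hb hab
        refine ⟨a • y + b • y', convex_convexHull ℝ _ hy hy' ha hb hab, ?_⟩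
        have e : a • x + b • x' - (a • y + b • y') = a • (x - y) + b • (x' - y') := by module
        rw [e]
        refine (map_add_le_add p _ _).trans ?_
        rw [map_smul_eq_mul, map_smul_eq_mul, Real.norm_of_nonneg ha, Real.norm_of_nonneg hb]
        calc a * p (x - y) + b * p (x' - y') ≤ a * δ + b * δ := by gcongr
          _ = δ := by rw [← add_mul, hab, one_mul]
      exact fun x hx => convexHull_min hn hconv hx
    have hPC : convexHull ℝ (P : Set W) ⊆ C :=
      convexHull_min ((Finset.coe_subset.2 (hP n₀ le_rfl)).trans (hsC n₀)) hC
    intro x hx y hy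
    obtain ⟨x', hx', hxx'⟩ := hnear x hx
    obtain ⟨y', hy', hyy'⟩ := hnear y hy
    have d1 := hGδ x (hconvC _ hx) x' (hPC hx') hxx'
    have d2 := hGδ y (hconvC _ hy) y' (hPC hy') hyy'
    have d3 := hGP x' hx' y' hy'
    have d4 := dist_triangle4_right (G x) (G y) (G x') (G y')
    have d5 := dist_triangle4 (G x) (G x') (G y') (G y)
    rw [dist_comm (G y') (G y)] at d5
    linarith

end termination

/-! ### Subdividing until all simplices are fine -/

section limit

/-- König's lemma: finite nonempty sets `A n` with maps `A (n + 1) → A n` have a compatible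
sequence of elements. -/
theorem exists_compatible_seq {A : ℕ → Type*} [∀ n, Finite (A n)] [∀ n, Nonempty (A n)]
    (f : ∀ n, A (n + 1) → A n) : ∃ a : ∀ n, A n, ∀ n, f n (a (n + 1)) = a n := by
  let Φ : CategoryTheory.Functor ℕᵒᵖ (Type _) :=
    CategoryTheory.Functor.ofOpSequence (X := A) fun n => TypeCat.ofHom (f n)
  have h1 : ∀ j, Finite (Φ.obj j) := fun j => inferInstanceAs (Finite (A j.unop))
  have h2 : ∀ j, Nonempty (Φ.obj j) := fun j => inferInstanceAs (Nonempty (A j.unop))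
  obtain ⟨u, hu⟩ := nonempty_sections_of_finite_inverse_system Φ
  refine ⟨fun n => u (Opposite.op n), fun n => ?_⟩
  have := hu (CategoryTheory.homOfLE (Nat.le_add_right n 1)).op
  rw [CategoryTheory.Functor.ofOpSequence_map_homOfLE_succ] at this
  exact this

variable {W : Type*} [AddCommGroup W] [Module ℝ W] {K F : Set (Finset W)} {s S : Finset W}
  {Q C : Set W}

/-- A convex set `C` is a face of `Q` as far as barycenters are concerned: if the barycenter of
points of `Q` is in `C`, then so are the points. -/
def IsBaryFace (Q C : Set W) : Prop :=
  ∀ t : Finset W, t.Nonempty → (t : Set W) ⊆ Q → bary t ∈ C → (t : Set W) ⊆ C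

theorem Carrier.carrier_subset (hC : IsBaryFace Q C) (hKQ : ∀ s ∈ K, (s : Set W) ⊆ Q)
    (h : Carrier K F s S) (hs : (s : Set W) ⊆ C) : (S : Set W) ⊆ C := by
  cases h with
  | keep => exact hs
  | @cone _ S₀ _ _ hS hK _ =>
    refine hC S ?_ (hKQ S hK) (hs (Finset.mem_coe.2 (Finset.mem_insert_self _ _)))
    exact Finset.Nonempty.mono (Finset.sdiff_subset (t := S₀)) (Finset.sdiff_nonempty.2 hS.2)

theorem Carrier.subset_image_bary (h : Carrier K F s S) : s ⊆ S ∪ S.powerset.image bary := by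
  induction h with
  | keep => exact Finset.subset_union_left
  | @cone s S₀ S _ hS _ _ ih =>
    refine Finset.insert_subset (Finset.mem_union_right _
      (Finset.mem_image_of_mem _ (Finset.mem_powerset_self S))) (ih.trans ?_)
    exact Finset.union_subset_union hS.1 (Finset.image_subset_image (Finset.powerset_mono.2 hS.1))

theorem finite_subdivision (hC : IsBaryFace Q C) (hKQ : ∀ s ∈ K, (s : Set W) ⊆ Q)
    (hfin : {s ∈ K | (s : Set W) ⊆ C}.Finite) :
    {s ∈ subdivision K F | (s : Set W) ⊆ C}.Finite := by
  refine (hfin.biUnion fun S _ => (S ∪ S.powerset.image bary).powerset.finite_toSet).subset ?_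
  rintro s ⟨⟨S, h⟩, hs⟩
  exact mem_biUnion (show S ∈ {s ∈ K | (s : Set W) ⊆ C} from ⟨h.mem, h.carrier_subset hC hKQ hs⟩)
    (Finset.mem_coe.2 (Finset.mem_powerset.2 h.subset_image_bary))

/-- The iterated subdivisions of `K`, in which the simplices of `F` are kept. -/
def iterSubdivision (K F : Set (Finset W)) : ℕ → Set (Finset W)
  | 0 => K
  | n + 1 => subdivision (iterSubdivision K F n) F

/-- The simplices that occur in the iterated subdivisions and are kept from then on. -/
def limitSubdivision (K F : Set (Finset W)) : Set (Finset W) :=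
  {s ∈ F | ∃ n, s ∈ iterSubdivision K F n}

theorem mem_iterSubdivision_of_le {m n : ℕ} (hmn : m ≤ n) (hF : s ∈ F)
    (hs : s ∈ iterSubdivision K F m) : s ∈ iterSubdivision K F n := by
  induction n, hmn using Nat.le_induction with
  | base => exact hs
  | succ n _ ih => exact ⟨s, .keep ih hF⟩

theorem isLowerSet_iterSubdivision (hK : IsLowerSet K) (hF : IsLowerSet F) (n : ℕ) :
    IsLowerSet (iterSubdivision K F n) := by
  induction n with
  | zero => exact hK
  | succ n ih => exact isLowerSet_subdivision ih hF

theorem UniqueWeights.iterSubdivision (hU : UniqueWeights K) (hK : IsLowerSet K)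
    (hF : IsLowerSet F) (n : ℕ) : UniqueWeights (iterSubdivision K F n) := by
  induction n with
  | zero => exact hU
  | succ n ih => exact ih.subdivision (isLowerSet_iterSubdivision hK hF n)

theorem exists_subset_convexHull_of_mem_iterSubdivision (n : ℕ) :
    ∀ s ∈ iterSubdivision K F n, ∃ S ∈ K, (s : Set W) ⊆ convexHull ℝ (S : Set W) := by
  induction n with
  | zero => exact fun s hs => ⟨s, hs, subset_convexHull ℝ _⟩
  | succ n ih =>
    rintro s ⟨S, h⟩
    obtain ⟨S', hS', hSS'⟩ := ih S h.mem
    exact ⟨S', hS', h.subset_convexHull.trans (convexHull_min hSS' (convex_convexHull ℝ _))⟩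

theorem iterSubdivision_subset (hQ : Convex ℝ Q) (hKQ : ∀ s ∈ K, (s : Set W) ⊆ Q) (n : ℕ) :
    ∀ s ∈ iterSubdivision K F n, (s : Set W) ⊆ Q := fun s hs => by
  obtain ⟨S, hS, h⟩ := exists_subset_convexHull_of_mem_iterSubdivision n s hs
  exact h.trans (convexHull_min (hKQ S hS) hQ)

theorem finite_iterSubdivision (hC : IsBaryFace Q C) (hQ : Convex ℝ Q)
    (hKQ : ∀ s ∈ K, (s : Set W) ⊆ Q) (hfin : {s ∈ K | (s : Set W) ⊆ C}.Finite) (n : ℕ) :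
    {s ∈ iterSubdivision K F n | (s : Set W) ⊆ C}.Finite := by
  induction n with
  | zero => exact hfin
  | succ n ih => exact finite_subdivision hC (iterSubdivision_subset hQ hKQ n) ih

theorem exists_weight_iterSubdivision (hK : IsLowerSet K) (hF : IsLowerSet F) (h0 : ∅ ∈ F)
    (e : W →₀ ℝ) (he : 0 ≤ e) (heK : e.support ∈ K) (n : ℕ) :
    ∃ t : W →₀ ℝ, 0 ≤ t ∧ t.support ∈ iterSubdivision K F n ∧ lin t = lin e ∧
      (t.support : Set W) ⊆ convexHull ℝ (e.support : Set W) := by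
  induction n with
  | zero => exact ⟨e, he, heK, rfl, subset_convexHull ℝ _⟩
  | succ n ih =>
    obtain ⟨t, ht, htK, hlin, hsub⟩ := ih
    obtain ⟨t', ht', hc, hlin'⟩ :=
      exists_carrier_of_weight (isLowerSet_iterSubdivision hK hF n) h0 t ht htK
    exact ⟨t', ht', ⟨_, hc⟩, hlin'.trans hlin,
      hc.subset_convexHull.trans (convexHull_min hsub (convex_convexHull ℝ _))⟩

variable {Y : Type*} [PseudoMetricSpace Y] {G : W → Y} {ε : ℝ}

/-- On a closed simplex on which `G` is uniformly continuous, all simplices are fine after finitely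
many subdivisions. -/
theorem exists_forall_mem_fineSets (hK : IsLowerSet K) (hU : UniqueWeights K) (hQ : Convex ℝ Q)
    (hKQ : ∀ s ∈ K, (s : Set W) ⊆ Q) (hε : 0 < ε) (hC : IsBaryFace Q C) (hCconv : Convex ℝ C)
    (hfin : {s ∈ K | (s : Set W) ⊆ C}.Finite) (p : Seminorm ℝ W)
    (hG : ∀ η > 0, ∃ δ > 0, ∀ x ∈ C, ∀ y ∈ C, p (x - y) ≤ δ → dist (G x) (G y) ≤ η) :
    ∃ n, ∀ s ∈ iterSubdivision K (fineSets G ε) n, (s : Set W) ⊆ C → s ∈ fineSets G ε := by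
  by_contra! hcon
  let A : ℕ → Type _ := fun n =>
    {s // (s ∈ iterSubdivision K (fineSets G ε) n ∧ (s : Set W) ⊆ C) ∧ s ∉ fineSets G ε}
  have hfinA : ∀ n, Finite (A n) := fun n =>
    ((finite_iterSubdivision hC hQ hKQ hfin n).subset (t := {s | (s ∈ iterSubdivision K
      (fineSets G ε) n ∧ (s : Set W) ⊆ C) ∧ s ∉ fineSets G ε}) fun s hs => hs.1).to_subtype
  have hneA : ∀ n, Nonempty (A n) := fun n =>
    let ⟨s, h1, h2, h3⟩ := hcon n
    ⟨⟨s, ⟨h1, h2⟩, h3⟩⟩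
  have hcarrier : ∀ n (a : A (n + 1)), ∃ b : A n,
      Carrier (iterSubdivision K (fineSets G ε) n) (fineSets G ε) a.1 b.1 := by
    rintro n ⟨s, ⟨⟨S, h⟩, hs⟩, hF⟩
    refine ⟨⟨S, ⟨h.mem, h.carrier_subset hC (iterSubdivision_subset hQ hKQ n) hs⟩, ?_⟩, h⟩
    rcases h.eq_or_notMem with rfl | hS
    · exact hF
    · exact hS
  choose f hf using hcarrier
  obtain ⟨a, ha⟩ := exists_compatible_seq f
  have hstep : ∀ n, Carrier (iterSubdivision K (fineSets G ε) n) (fineSets G ε)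
      (a (n + 1)).1 (a n).1 := fun n => ha n ▸ hf n (a (n + 1))
  have hv := fun n => (hstep n).vertices (hU.iterSubdivision hK isLowerSet_fineSets n)
    (isLowerSet_iterSubdivision hK isLowerSet_fineSets n) (singleton_mem_fineSets hε)
  obtain ⟨n, hn⟩ := exists_mem_fineSets hε p hCconv hG (fun n => (a n).1)
    (fun n => (a n).2.1.2) (fun n => (hstep n).card_le) (fun n => (hv n).1)
    (fun n => (hv n).2.1) (fun n => (hv n).2.2)
  exact (a n).2.2 hn

theorem isLowerSet_limitSubdivision (hK : IsLowerSet K) (hF : IsLowerSet F) :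
    IsLowerSet (limitSubdivision K F) := by
  rintro s t hts ⟨hs, n, hn⟩
  exact ⟨hF hts hs, n, isLowerSet_iterSubdivision hK hF n hts hn⟩

theorem UniqueWeights.limitSubdivision (hU : UniqueWeights K) (hK : IsLowerSet K)
    (hF : IsLowerSet F) : UniqueWeights (limitSubdivision K F) := by
  rintro t t' h0 h0' ⟨hF1, n, hn⟩ ⟨hF2, n', hn'⟩ hlin
  exact hU.iterSubdivision hK hF (max n n') h0 h0'
    (mem_iterSubdivision_of_le (le_max_left _ _) hF1 hn)
    (mem_iterSubdivision_of_le (le_max_right _ _) hF2 hn') hlin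

/-- If all simplices in `C` are fine at some stage, then `C` is not subdivided any more. -/
theorem mem_iterSubdivision_of_mem_limitSubdivision (hC : IsBaryFace Q C) (hQ : Convex ℝ Q)
    (hKQ : ∀ s ∈ K, (s : Set W) ⊆ Q) {N : ℕ}
    (hN : ∀ s ∈ iterSubdivision K F N, (s : Set W) ⊆ C → s ∈ F)
    (hs : s ∈ limitSubdivision K F) (hsC : (s : Set W) ⊆ C) : s ∈ iterSubdivision K F N := by
  have key : ∀ m, N ≤ m → ∀ s ∈ iterSubdivision K F m, (s : Set W) ⊆ C →
      s ∈ F ∧ s ∈ iterSubdivision K F N := by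
    intro m hm
    induction m, hm using Nat.le_induction with
    | base => exact fun s hs hsC => ⟨hN s hs hsC, hs⟩
    | succ m hm ih =>
      rintro s ⟨S, hS⟩ hsC
      have := ih S hS.mem (hS.carrier_subset hC (iterSubdivision_subset hQ hKQ m) hsC)
      rcases hS.eq_or_notMem with rfl | h
      · exact this
      · exact absurd this.1 h
  obtain ⟨hF, n, hn⟩ := hs
  rcases le_total n N with h | h
  · exact mem_iterSubdivision_of_le h hF hn
  · exact (key n h s hn hsC).2

/-- A complex that is finite on each of the closed simplices `C ∈ 𝒞` has a subdivision that is
finite on each of them, and on each simplex of which `G` oscillates by less than `ε`, provided that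
`G` is uniformly continuous on each `C ∈ 𝒞`. -/
theorem exists_fine_subdivision (hK : IsLowerSet K) (hU : UniqueWeights K) (hQ : Convex ℝ Q)
    (hKQ : ∀ s ∈ K, (s : Set W) ⊆ Q) (hε : 0 < ε) (𝒞 : Set (Set W))
    (hface : ∀ C ∈ 𝒞, IsBaryFace Q C) (hconv : ∀ C ∈ 𝒞, Convex ℝ C)
    (hfin : ∀ C ∈ 𝒞, {s ∈ K | (s : Set W) ⊆ C}.Finite)
    (hG : ∀ C ∈ 𝒞, ∃ p : Seminorm ℝ W, ∀ η > 0, ∃ δ > 0, ∀ x ∈ C, ∀ y ∈ C,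
      p (x - y) ≤ δ → dist (G x) (G y) ≤ η)
    (hcover : ∀ s ∈ K, ∃ C ∈ 𝒞, (s : Set W) ⊆ C) :
    ∃ L : Set (Finset W), IsLowerSet L ∧ UniqueWeights L ∧ L ⊆ fineSets G ε ∧
      (∀ s ∈ L, ∃ S ∈ K, (s : Set W) ⊆ convexHull ℝ (S : Set W)) ∧
      (∀ e : W →₀ ℝ, 0 ≤ e → e.support ∈ K →
        ∃ t : W →₀ ℝ, 0 ≤ t ∧ t.support ∈ L ∧ lin t = lin e) ∧
      ∀ C ∈ 𝒞, {s ∈ L | (s : Set W) ⊆ C}.Finite := by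
  have hF : IsLowerSet (fineSets G ε) := isLowerSet_fineSets
  have hfineC : ∀ C ∈ 𝒞, ∃ n, ∀ s ∈ iterSubdivision K (fineSets G ε) n,
      (s : Set W) ⊆ C → s ∈ fineSets G ε := fun C hC =>
    let ⟨p, hp⟩ := hG C hC
    exists_forall_mem_fineSets hK hU hQ hKQ hε (hface C hC) (hconv C hC) (hfin C hC) p hp
  refine ⟨limitSubdivision K (fineSets G ε), isLowerSet_limitSubdivision hK hF,
    hU.limitSubdivision hK hF, fun s hs => hs.1,
    fun s ⟨_, n, hn⟩ => exists_subset_convexHull_of_mem_iterSubdivision n s hn,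
    fun e he heK => ?_, fun C hC => ?_⟩
  · obtain ⟨C, hC, heC⟩ := hcover _ heK
    obtain ⟨n, hn⟩ := hfineC C hC
    obtain ⟨t, ht, htK, hlin, hsub⟩ :=
      exists_weight_iterSubdivision hK hF (empty_mem_fineSets hε) e he heK n
    exact ⟨t, ht, ⟨hn _ htK (hsub.trans (convexHull_min heC (hconv C hC))), n, htK⟩, hlin⟩
  · obtain ⟨n, hn⟩ := hfineC C hC
    exact (finite_iterSubdivision (hface C hC) hQ hKQ (hfin C hC) n).subset fun s hs =>
      ⟨mem_iterSubdivision_of_mem_limitSubdivision (hface C hC) hQ hKQ hn hs.1 hs.2, hs.2⟩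

end limit

/-! ### The topology of a geometric realization -/

section realization

universe u₁ u₂

namespace Realization

variable {ι : Type u₁} {K : PreAbstractSimplicialComplex ι}

theorem coord_injective : Function.Injective (coord : Realization K → ι →₀ ℝ) :=
  Subtype.val_injective

theorem coord_sum_of_subset (x : Realization K) {s : Finset ι} (hs : x.coord.support ⊆ s) :
    ∑ i ∈ s, x.coord i = 1 := by
  rw [← x.2.2.2]
  exact (Finsupp.sum_of_support_subset (x.coord) hs (fun _ t => t) fun _ _ => rfl).symm

instance : T2Space (Realization K) := by
  refine T2Space.of_injective_continuous (Y := ι → ℝ) (f := fun x i => x.coord i) ?_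
    (continuous_pi continuous_coord)
  intro x y h
  exact coord_injective (Finsupp.ext fun i => congrFun h i)

theorem continuous_incl {s : Finset ι} (hs : s ∈ K.faces) :
    Continuous (ClosedSimplex.incl : ClosedSimplex K s → Realization K) :=
  continuous_iff_coinduced_le.2 (le_iSup (fun s : K.faces => TopologicalSpace.coinduced
    (ClosedSimplex.incl : ClosedSimplex K (s : Finset ι) → Realization K) inferInstance) ⟨s, hs⟩)

/-- A map into `|K|` is continuous if it maps to a closed simplex and its barycentric coordinates
are continuous. -/
theorem continuous_of_forall_coord {X : Type*} [TopologicalSpace X] {s : Finset ι}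
    (hs : s ∈ K.faces) (f : X → Realization K) (hf : ∀ x, (f x).coord.support ⊆ s)
    (hc : ∀ i, Continuous fun x => (f x).coord i) : Continuous f := by
  let f' : X → ClosedSimplex K s := fun x => ⟨f x, hf x⟩
  have hf' : Continuous f' := continuous_induced_rng.2 (continuous_pi hc)
  exact (continuous_incl hs).comp hf'

/-- If there are finitely many vertices, a map into `|K|` is continuous if its barycentric
coordinates are. -/
theorem continuous_of_finite [Finite ι] {X : Type*} [TopologicalSpace X] (f : X → Realization K)
    (hc : ∀ i, Continuous fun x => (f x).coord i) : Continuous f := by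
  -- The preimages of the closed simplices form a finite closed cover.
  have hclosed : ∀ s : K.faces, IsClosed {x | (f x).coord.support ⊆ s} := by
    intro s
    have : {x | (f x).coord.support ⊆ s} =
        ⋂ (i) (_ : i ∉ (s : Finset ι)), {x | (f x).coord i = 0} := by
      ext x
      simp only [mem_ofPred_eq, mem_iInter]
      exact ⟨fun h i hi => Finsupp.notMem_support_iff.1 fun h' => hi (h h'), fun h i hi => by
        by_contra h'
        exact Finsupp.mem_support_iff.1 hi (h i h')⟩
    rw [this]
    exact isClosed_biInter fun i _ => isClosed_eq (hc i) continuous_const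
  refine (locallyFinite_of_finite fun s : K.faces => {x | (f x).coord.support ⊆ s}).continuous
    ?_ hclosed fun s => ?_
  · exact eq_univ_of_forall fun x => mem_iUnion.2 ⟨⟨_, (f x).2.1⟩, Finset.Subset.refl _⟩
  · rw [continuousOn_iff_continuous_domRestrict]
    exact continuous_of_forall_coord s.2 _ (fun x => x.2) fun i =>
      (hc i).comp continuous_subtype_val

/-- A map defined on `|K|` is continuous if it is so on each closed simplex. -/
theorem continuous_of_forall_closedSimplex {Y : Type*} [TopologicalSpace Y] (f : Realization K → Y)
    (h : ∀ s ∈ K.faces, Continuous fun x : ClosedSimplex K s => f x.incl) : Continuous f :=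
  continuous_iSup_dom.2 fun s => continuous_coinduced_dom.2 (h s s.2)

theorem continuous_coord_closedSimplex {s : Finset ι} (i : ι) :
    Continuous fun x : ClosedSimplex K s => x.incl.coord i :=
  (continuous_apply i).comp continuous_induced_dom

theorem isClosed_of_forall_face {Z : Set (Realization K)}
    (h : ∀ s ∈ K.faces, IsClosed (Z ∩ {x | x.coord.support ⊆ s})) : IsClosed Z := by
  refine isClosed_iSup_iff.2 fun s => isClosed_coinduced.2 ?_
  have : (ClosedSimplex.incl : ClosedSimplex K (s : Finset ι) → Realization K) ⁻¹' Z =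
      ClosedSimplex.incl ⁻¹' (Z ∩ {x | x.coord.support ⊆ s}) := by
    ext x
    exact ⟨fun hx => ⟨hx, x.2⟩, fun hx => hx.1⟩
  rw [this]
  exact (h s s.2).preimage (continuous_incl s.2)

/-- The point of the closed simplex `s` with given barycentric coordinates. -/
noncomputable def ofStdSimplex {s : Finset ι} (hs : s ∈ K.faces) (w : stdSimplex ℝ s) :
    Realization K :=
  ⟨Finsupp.onFinset s (fun i => if h : i ∈ s then w.1 ⟨i, h⟩ else 0) fun i hi => by
      by_contra h
      simp [h] at hi, by
    have hsum : ∑ i ∈ s, (if h : i ∈ s then w.1 ⟨i, h⟩ else 0) = 1 := by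
      rw [← w.2.2, ← Finset.sum_coe_sort s]
      exact Finset.sum_congr rfl fun i _ => by simp
    refine ⟨(K.isRelLowerSet_faces hs).2 Finsupp.support_onFinset_subset ?_, fun i => ?_, ?_⟩
    · by_contra h
      rw [Finset.not_nonempty_iff_eq_empty, Finsupp.support_eq_empty] at h
      refine one_ne_zero (hsum.symm.trans (Finset.sum_eq_zero fun i _ => ?_))
      exact DFunLike.congr_fun h i
    · rw [Finsupp.onFinset_apply]
      split_ifs with h
      · exact w.2.1 ⟨i, h⟩
      · exact le_rfl
    · rw [Finsupp.onFinset_sum _ fun _ => rfl]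
      exact hsum⟩

theorem coord_ofStdSimplex {s : Finset ι} (hs : s ∈ K.faces) (w : stdSimplex ℝ s) (i : ι) :
    (ofStdSimplex hs w).coord i = if h : i ∈ s then w.1 ⟨i, h⟩ else 0 := rfl

theorem support_ofStdSimplex {s : Finset ι} (hs : s ∈ K.faces) (w : stdSimplex ℝ s) :
    (ofStdSimplex hs w).coord.support ⊆ s := by
  intro i hi
  by_contra h
  rw [Finsupp.mem_support_iff, coord_ofStdSimplex, dif_neg h] at hi
  exact hi rfl

theorem continuous_ofStdSimplex {s : Finset ι} (hs : s ∈ K.faces) :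
    Continuous (ofStdSimplex hs) := by
  refine continuous_of_forall_coord hs _ (support_ofStdSimplex hs) fun i => ?_
  simp only [coord_ofStdSimplex]
  split_ifs with h
  · exact (continuous_apply _).comp continuous_subtype_val
  · exact continuous_const

/-- The barycentric coordinates of a point of the closed simplex `s`. -/
noncomputable def toStdSimplex {s : Finset ι} (x : Realization K) (hx : x.coord.support ⊆ s) :
    stdSimplex ℝ s :=
  ⟨fun i => x.coord i, fun i => x.2.2.1 i, by
    rw [Finset.sum_coe_sort s fun i => x.coord i]
    exact x.coord_sum_of_subset hx⟩

theorem ofStdSimplex_toStdSimplex {s : Finset ι} (hs : s ∈ K.faces) (x : Realization K)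
    (hx : x.coord.support ⊆ s) : ofStdSimplex hs (x.toStdSimplex hx) = x := by
  refine coord_injective (Finsupp.ext fun i => ?_)
  rw [coord_ofStdSimplex]
  split_ifs with h
  · rfl
  · exact (Finsupp.notMem_support_iff.1 fun hi => h (hx hi)).symm

theorem isCompact_closedSimplex {s : Finset ι} (hs : s ∈ K.faces) :
    IsCompact {x : Realization K | x.coord.support ⊆ s} := by
  have : {x : Realization K | x.coord.support ⊆ s} = range (ofStdSimplex hs) := by
    ext x
    constructor
    · exact fun hx => ⟨x.toStdSimplex hx, ofStdSimplex_toStdSimplex hs x hx⟩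
    · rintro ⟨w, rfl⟩
      exact support_ofStdSimplex hs w
  rw [this]
  exact isCompact_range (continuous_ofStdSimplex hs)

/-- A continuous map is uniformly continuous on each closed simplex. -/
theorem exists_dist_le_of_continuous {Y : Type*} [PseudoMetricSpace Y] (g : C(Realization K, Y))
    {s : Finset ι} (hs : s ∈ K.faces) {η : ℝ} (hη : 0 < η) :
    ∃ δ > 0, ∀ x y : Realization K, x.coord.support ⊆ s → y.coord.support ⊆ s →
      ‖fun i : s => x.coord i - y.coord i‖ ≤ δ → dist (g x) (g y) ≤ η := by
  have hu : UniformContinuous fun w : stdSimplex ℝ s => g (ofStdSimplex hs w) :=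
    CompactSpace.uniformContinuous_of_continuous
      (g.continuous.comp (continuous_ofStdSimplex hs))
  obtain ⟨δ, hδ, h⟩ := Metric.uniformContinuous_iff.1 hu η hη
  refine ⟨δ / 2, half_pos hδ, fun x y hx hy hxy => ?_⟩
  have := @h (x.toStdSimplex hx) (y.toStdSimplex hy) (by
    rw [Subtype.dist_eq, dist_eq_norm]
    exact lt_of_le_of_lt hxy (half_lt_self hδ))
  rw [ofStdSimplex_toStdSimplex, ofStdSimplex_toStdSimplex] at this
  exact this.le

/-- A continuous bijection of geometric realizations is a homeomorphism if the preimages of closed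
simplices are compact. -/
noncomputable def homeoOfBijective {κ : Type u₂} {K' : PreAbstractSimplicialComplex κ}
    (f : Realization K' → Realization K) (hf : Continuous f) (hb : Function.Bijective f)
    (hc : ∀ s ∈ K.faces, IsCompact (f ⁻¹' {x | x.coord.support ⊆ s})) :
    Realization K' ≃ₜ Realization K :=
  (Equiv.ofBijective f hb).toHomeomorphOfContinuousClosed hf (by
    intro Z hZ
    refine isClosed_of_forall_face fun s hs => ?_
    change IsClosed (f '' Z ∩ _)
    rw [← image_inter_preimage]
    exact (((hc s hs).inter_left hZ).image hf).isClosed)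

end Realization

end realization

/-! ### Fine triangulations of a geometric realization -/

section fine

universe u₁

variable {ι : Type u₁}

/-- The vertex `i` as a point of the realization. -/
noncomputable def vertexPoint : ι ↪ (ι →₀ ℝ) :=
  ⟨fun i => Finsupp.single i 1, Finsupp.single_left_injective one_ne_zero⟩

theorem vertexPoint_apply (i : ι) : vertexPoint i = Finsupp.single i (1 : ℝ) := rfl

/-- The simplices of `K` and the empty simplex, as sets of points. -/
def pointSimplices (K : PreAbstractSimplicialComplex ι) : Set (Finset (ι →₀ ℝ)) :=
  {A | ∃ s, (s = ∅ ∨ s ∈ K.faces) ∧ A = s.map vertexPoint}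

/-- The sum of the coordinates. -/
noncomputable def coordSum : (ι →₀ ℝ) →ₗ[ℝ] ℝ := Finsupp.linearCombination ℝ fun _ => 1

theorem coordSum_apply (x : ι →₀ ℝ) : coordSum x = x.sum fun _ t => t := by
  simp [coordSum, Finsupp.linearCombination_apply]

/-- The standard simplex with vertex set `ι`. -/
def fullSimplex (ι : Type u₁) : Set (ι →₀ ℝ) := {x | 0 ≤ x ∧ coordSum x = 1}

/-- The face of the standard simplex with vertex set `s`. -/
def cell (s : Finset ι) : Set (ι →₀ ℝ) := {x | x ∈ fullSimplex ι ∧ x.support ⊆ s}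

theorem convex_fullSimplex : Convex ℝ (fullSimplex ι) := by
  rintro x ⟨hx, hx'⟩ y ⟨hy, hy'⟩ a b ha hb hab
  refine ⟨add_nonneg (smul_nonneg ha hx) (smul_nonneg hb hy), ?_⟩
  rw [map_add, map_smul, map_smul, hx', hy', smul_eq_mul, smul_eq_mul, mul_one, mul_one, hab]

theorem support_subset_iff_forall {x : ι →₀ ℝ} {s : Finset ι} :
    x.support ⊆ s ↔ ∀ i ∉ s, x i = 0 :=
  ⟨fun h i hi => Finsupp.notMem_support_iff.1 fun h' => hi (h h'), fun h i hi => by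
    by_contra h'
    exact Finsupp.mem_support_iff.1 hi (h i h')⟩

theorem convex_cell (s : Finset ι) : Convex ℝ (cell s) := by
  rintro x ⟨hx, hx'⟩ y ⟨hy, hy'⟩ a b ha hb hab
  refine ⟨convex_fullSimplex hx hy ha hb hab, ?_⟩
  rw [support_subset_iff_forall] at hx' hy' ⊢
  intro i hi
  simp [hx' i hi, hy' i hi]

theorem vertexPoint_mem_cell {s : Finset ι} {i : ι} (hi : i ∈ s) : vertexPoint i ∈ cell s := by
  refine ⟨⟨Finsupp.single_nonneg.2 zero_le_one, ?_⟩, ?_⟩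
  · rw [coordSum_apply, vertexPoint_apply, Finsupp.sum_single_index rfl]
  · rw [vertexPoint_apply, Finsupp.support_single _ one_ne_zero]
    exact Finset.singleton_subset_iff.2 hi

theorem map_vertexPoint_subset_cell (s : Finset ι) :
    (s.map vertexPoint : Set (ι →₀ ℝ)) ⊆ cell s := by
  intro a ha
  obtain ⟨i, hi, rfl⟩ := Finset.mem_map.1 (Finset.mem_coe.1 ha)
  exact vertexPoint_mem_cell hi

theorem lin_apply (t : (ι →₀ ℝ) →₀ ℝ) (i : ι) : lin t i = ∑ a ∈ t.support, t a * a i := by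
  rw [Finsupp.linearCombination_apply, Finsupp.sum, Finsupp.finsetSum_apply]
  rfl

theorem isBaryFace_cell (s : Finset ι) : IsBaryFace (fullSimplex ι) (cell s) := by
  intro t ht htQ hb a ha
  refine ⟨htQ ha, ?_⟩
  have hb' := support_subset_iff_forall.1 hb.2
  rw [support_subset_iff_forall]
  intro i hi
  have h1 := hb' i hi
  have hc : (t.card : ℝ)⁻¹ ≠ 0 := inv_ne_zero (by exact_mod_cast ht.card_pos.ne')
  rw [bary, Finsupp.smul_apply, Finsupp.finsetSum_apply, smul_eq_mul, mul_eq_zero,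
    or_iff_right hc, Finset.sum_eq_zero_iff_of_nonneg fun b hb => (htQ hb).1 i] at h1
  exact h1 a ha

/-- A point of the hull of some points lies in a face if and only if all points with a positive
weight do. -/
theorem support_lin_subset_iff {t : (ι →₀ ℝ) →₀ ℝ} (ht : 0 ≤ t) (ht' : ∀ a ∈ t.support, 0 ≤ a)
    {s : Finset ι} : (lin t).support ⊆ s ↔ ∀ a ∈ t.support, a.support ⊆ s := by
  simp only [support_subset_iff_forall]
  constructor
  · intro h a ha i hi
    have h1 := h i hi
    rw [lin_apply, Finset.sum_eq_zero_iff_of_nonneg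
      fun b hb => mul_nonneg (ht b) (ht' b hb i)] at h1
    exact (mul_eq_zero.1 (h1 a ha)).resolve_left (Finsupp.mem_support_iff.1 ha)
  · intro h i hi
    rw [lin_apply]
    exact Finset.sum_eq_zero fun a ha => by rw [h a ha i hi, mul_zero]

theorem coordSum_lin {t : (ι →₀ ℝ) →₀ ℝ} (ht : ∀ a ∈ t.support, coordSum a = 1) :
    coordSum (lin t) = t.sum fun _ c => c := by
  rw [Finsupp.linearCombination_apply, Finsupp.sum, map_sum]
  exact Finset.sum_congr rfl fun a ha => by rw [map_smul, id, ht a ha, smul_eq_mul, mul_one]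

variable {K : PreAbstractSimplicialComplex ι}

theorem isLowerSet_pointSimplices : IsLowerSet (pointSimplices K) := by
  rintro _ B hB ⟨s, hs, rfl⟩
  obtain ⟨t, hts, rfl⟩ := Finset.subset_map_iff.1 hB
  refine ⟨t, ?_, rfl⟩
  rcases t.eq_empty_or_nonempty with rfl | hne
  · exact Or.inl rfl
  · refine Or.inr (hs.elim (fun h => ?_) fun h => (K.isRelLowerSet_faces h).2 hts hne)
    rw [h, Finset.subset_empty] at hts
    exact absurd hts hne.ne_empty

theorem lin_apply_of_support_subset {t : (ι →₀ ℝ) →₀ ℝ} {s : Finset ι}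
    (ht : t.support ⊆ s.map vertexPoint) (i : ι) : lin t i = t (vertexPoint i) := by
  rw [lin_apply, Finset.sum_eq_single (vertexPoint i)]
  · simp [vertexPoint_apply]
  · intro a ha hai
    obtain ⟨j, -, rfl⟩ := Finset.mem_map.1 (ht ha)
    have : j ≠ i := fun h => hai (h ▸ rfl)
    simp [vertexPoint_apply, this]
  · intro h
    rw [Finsupp.notMem_support_iff.1 h, zero_mul]

theorem uniqueWeights_pointSimplices : UniqueWeights (pointSimplices K) := by
  rintro t t' - - ⟨s, -, hs⟩ ⟨s', -, hs'⟩ h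
  ext a
  by_cases ha : ∃ i, a = vertexPoint i
  · obtain ⟨i, rfl⟩ := ha
    rw [← lin_apply_of_support_subset hs.subset, ← lin_apply_of_support_subset hs'.subset, h]
  · have key : ∀ (u : (ι →₀ ℝ) →₀ ℝ) (r : Finset ι), u.support = r.map vertexPoint → u a = 0 := by
      intro u r hr
      refine Finsupp.notMem_support_iff.1 fun hu => ha ?_
      obtain ⟨i, -, rfl⟩ := Finset.mem_map.1 (hr ▸ hu)
      exact ⟨i, rfl⟩
    rw [key t s hs, key t' s' hs']

theorem exists_mem_faces_of_subset_cell {A : Finset (ι →₀ ℝ)} (hA : A.Nonempty)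
    {S : Finset (ι →₀ ℝ)} (hS : S ∈ pointSimplices K)
    (hAS : (A : Set (ι →₀ ℝ)) ⊆ convexHull ℝ (S : Set (ι →₀ ℝ))) :
    ∃ s ∈ K.faces, (A : Set (ι →₀ ℝ)) ⊆ cell s := by
  obtain ⟨s, hs, rfl⟩ := hS
  have h : (A : Set (ι →₀ ℝ)) ⊆ cell s :=
    hAS.trans (convexHull_min (map_vertexPoint_subset_cell s) (convex_cell s))
  refine ⟨s, hs.resolve_left ?_, h⟩
  rintro rfl
  obtain ⟨a, ha⟩ := hA
  simp at hAS
  simp [hAS] at ha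

/-- A continuous map on a geometric realization, as a function of the barycentric coordinates, is
fine on the simplices of a suitable subdivision. -/
theorem exists_fine_pointSimplices {Y : Type*} [PseudoMetricSpace Y] (g : C(Realization K, Y))
    (G : (ι →₀ ℝ) → Y) (hG : ∀ x, G x.coord = g x) {ε : ℝ} (hε : 0 < ε) :
    ∃ L : Set (Finset (ι →₀ ℝ)), IsLowerSet L ∧ UniqueWeights L ∧ L ⊆ fineSets G ε ∧
      (∀ A ∈ L, A.Nonempty → ∃ s ∈ K.faces, (A : Set (ι →₀ ℝ)) ⊆ cell s) ∧
      (∀ x : Realization K, ∃ t : (ι →₀ ℝ) →₀ ℝ, 0 ≤ t ∧ t.support ∈ L ∧ lin t = x.coord) ∧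
      ∀ s ∈ K.faces, {A ∈ L | (A : Set (ι →₀ ℝ)) ⊆ cell s}.Finite := by
  have hsub : ∀ A ∈ pointSimplices K, (A : Set (ι →₀ ℝ)) ⊆ fullSimplex ι := by
    rintro _ ⟨s, -, rfl⟩
    exact (map_vertexPoint_subset_cell s).trans fun x hx => hx.1
  obtain ⟨L, h1, h2, h3, h4, h5, h6⟩ := exists_fine_subdivision (G := G)
    (isLowerSet_pointSimplices (K := K)) uniqueWeights_pointSimplices convex_fullSimplex
    hsub hε (cell '' insert ∅ K.faces) (by
      rintro _ ⟨s, -, rfl⟩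
      exact isBaryFace_cell s) (by
      rintro _ ⟨s, -, rfl⟩
      exact convex_cell s) (by
      rintro _ ⟨s, -, rfl⟩
      refine (s.map vertexPoint).powerset.finite_toSet.subset ?_
      rintro _ ⟨⟨t, -, rfl⟩, ht⟩
      rw [Finset.mem_coe, Finset.mem_powerset, Finset.map_subset_map]
      intro i hi
      have := (ht (Finset.mem_coe.2 (Finset.mem_map_of_mem _ hi))).2
      rw [vertexPoint_apply, Finsupp.support_single _ one_ne_zero] at this
      exact Finset.singleton_subset_iff.1 this) (by
      rintro _ ⟨s, hs, rfl⟩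
      refine ⟨(normSeminorm ℝ (s → ℝ)).comp
        (LinearMap.pi fun i : s => Finsupp.lapply (i : ι)), fun η hη => ?_⟩
      rcases hs with rfl | hs
      · refine ⟨1, one_pos, fun x hx => ?_⟩
        have h0 := hx.1.2
        rw [Finset.subset_empty.1 hx.2 |> Finsupp.support_eq_empty.1, map_zero] at h0
        exact absurd h0 zero_ne_one
      · obtain ⟨δ, hδ, h⟩ := Realization.exists_dist_le_of_continuous g hs hη
        refine ⟨δ, hδ, fun x hx y hy hxy => ?_⟩
        have lift : ∀ z ∈ cell s, ∃ z' : Realization K, z'.coord = z := by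
          intro z hz
          refine ⟨⟨z, (K.isRelLowerSet_faces hs).2 hz.2 ?_, hz.1.1, ?_⟩, rfl⟩
          · by_contra h0
            rw [Finset.not_nonempty_iff_eq_empty, Finsupp.support_eq_empty] at h0
            have := hz.1.2
            rw [h0, map_zero] at this
            exact absurd this zero_ne_one
          · rw [← coordSum_apply, hz.1.2]
        obtain ⟨x, rfl⟩ := lift x hx
        obtain ⟨y, rfl⟩ := lift y hy
        rw [hG, hG]
        refine h x y hx.2 hy.2 ?_
        have e : (fun i : s => x.coord i - y.coord i) =
            (LinearMap.pi fun i : s => Finsupp.lapply (R := ℝ) (i : ι)) (x.coord - y.coord) := by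
          ext i
          simp
        rw [e]
        exact hxy) (by
      rintro _ ⟨s, hs, rfl⟩
      exact ⟨cell s, ⟨s, hs, rfl⟩, map_vertexPoint_subset_cell s⟩)
  refine ⟨L, h1, h2, h3, fun A hA hne => ?_, fun x => ?_, fun s hs => h6 _ ⟨s, Or.inr hs, rfl⟩⟩
  · obtain ⟨S, hS, hAS⟩ := h4 A hA
    exact exists_mem_faces_of_subset_cell hne hS hAS
  · have hsupp : (x.coord.embDomain vertexPoint).support = x.coord.support.map vertexPoint :=
      Finsupp.support_embDomain _ _
    obtain ⟨t, ht, htL, hlin⟩ := h5 (x.coord.embDomain vertexPoint) (by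
      intro a
      by_cases ha : a ∈ range vertexPoint
      · obtain ⟨i, rfl⟩ := ha
        rw [Finsupp.embDomain_apply_self]
        exact x.2.2.1 i
      · rw [Finsupp.embDomain_of_notMem_range _ _ _ ha]
        rfl) ⟨_, Or.inr x.2.1, hsupp⟩
    refine ⟨t, ht, htL, hlin.trans (Finsupp.ext fun i => ?_)⟩
    rw [lin_apply_of_support_subset hsupp.subset, Finsupp.embDomain_apply_self]

/-- The vertices of a set of simplices. -/
abbrev PointVertex (L : Set (Finset (ι →₀ ℝ))) : Type u₁ := {a : ι →₀ ℝ // {a} ∈ L}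

/-- The abstract simplicial complex whose simplices are the nonempty members of `L`. -/
def pointComplex (L : Set (Finset (ι →₀ ℝ))) (hL : IsLowerSet L) :
    AbstractSimplicialComplex (PointVertex L) where
  faces := {s | s.Nonempty ∧ s.map (Function.Embedding.subtype _) ∈ L}
  isRelLowerSet_faces := fun _ hs => ⟨hs.1, fun _ hts ht =>
    ⟨ht, hL (Finset.map_subset_map.2 hts) hs.2⟩⟩
  singleton_mem := fun a => ⟨Finset.singleton_nonempty a, by
    rw [Finset.map_singleton]
    exact a.2⟩

/-- The weights of a point of `|pointComplex L|`, as weights of points of `|K|`. -/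
noncomputable def pointWeight {L : Set (Finset (ι →₀ ℝ))} {hL : IsLowerSet L}
    (x : Realization (pointComplex L hL).toPreAbstractSimplicialComplex) : (ι →₀ ℝ) →₀ ℝ :=
  x.coord.embDomain (Function.Embedding.subtype _)

section pointWeight

variable {L : Set (Finset (ι →₀ ℝ))} {hL : IsLowerSet L}
  (x : Realization (pointComplex L hL).toPreAbstractSimplicialComplex)

theorem support_pointWeight :
    (pointWeight x).support = x.coord.support.map (Function.Embedding.subtype _) :=
  Finsupp.support_embDomain _ _

theorem support_pointWeight_mem : (pointWeight x).support ∈ L := by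
  rw [support_pointWeight]
  exact x.2.1.2

theorem pointWeight_nonneg : 0 ≤ pointWeight x := by
  intro a
  by_cases ha : a ∈ range (Function.Embedding.subtype fun a : ι →₀ ℝ => {a} ∈ L)
  · obtain ⟨i, rfl⟩ := ha
    rw [pointWeight, Finsupp.embDomain_apply_self]
    exact x.2.2.1 i
  · rw [pointWeight, Finsupp.embDomain_of_notMem_range _ _ _ ha]
    rfl

theorem lin_pointWeight_of_subset {s : Finset (PointVertex L)}
    (hs : x.coord.support ⊆ s) : lin (pointWeight x) = ∑ a ∈ s, x.coord a • (a : ι →₀ ℝ) := by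
  rw [pointWeight, Finsupp.linearCombination_embDomain, Finsupp.linearCombination_apply,
    Finsupp.sum_of_support_subset _ hs _ (by simp)]
  rfl

theorem lin_pointWeight_mem {s : Finset (PointVertex L)}
    (hs : x.coord.support ⊆ s) {C : Set (ι →₀ ℝ)} (hC : Convex ℝ C)
    (hsC : ∀ a ∈ s, (a : ι →₀ ℝ) ∈ C) : lin (pointWeight x) ∈ C := by
  rw [lin_pointWeight_of_subset x hs]
  exact hC.sum_mem (fun a _ => x.2.2.1 a) (x.coord_sum_of_subset hs) hsC

end pointWeight

/-- Every map on a geometric realization oscillates by less than `ε` on each simplex of a suitable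
triangulation. -/
theorem exists_fine_triangulation {Y : Type*} [PseudoMetricSpace Y] [Nonempty Y]
    (g : C(Realization K, Y)) {ε : ℝ} (hε : 0 < ε) :
    ∃ (V : Type u₁) (K' : AbstractSimplicialComplex V)
      (φ : Realization K'.toPreAbstractSimplicialComplex ≃ₜ Realization K),
      ∀ s ∈ K'.faces, ∀ x y, x.coord.support ⊆ s → y.coord.support ⊆ s →
        dist (g (φ x)) (g (φ y)) < ε := by
  obtain ⟨G, hG⟩ : ∃ G : (ι →₀ ℝ) → Y, ∀ x, G x.coord = g x :=
    ⟨Function.extend Realization.coord g fun _ => Classical.arbitrary Y, fun x =>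
      Realization.coord_injective.extend_apply _ _ x⟩
  obtain ⟨L, hL, hU, hfine, hcell, hsurj, hfin⟩ := exists_fine_pointSimplices g G hG hε
  let K' := (pointComplex L hL).toPreAbstractSimplicialComplex
  have hface : ∀ s ∈ K'.faces, ∃ r ∈ K.faces, ∀ a ∈ s, (a : ι →₀ ℝ) ∈ cell r := by
    rintro s ⟨hne, hsL⟩
    obtain ⟨r, hr, h⟩ := hcell _ hsL (by simpa using hne)
    exact ⟨r, hr, fun a ha => h (Finset.mem_coe.2 (Finset.mem_map_of_mem _ ha))⟩
  have hmem : ∀ x : Realization K', (lin (pointWeight x)).support ∈ K.faces ∧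
      (∀ i, 0 ≤ lin (pointWeight x) i) ∧ ((lin (pointWeight x)).sum fun _ t => t) = 1 := by
    intro x
    obtain ⟨r, hr, h⟩ := hface _ x.2.1
    have hx := lin_pointWeight_mem x subset_rfl (convex_cell r) h
    refine ⟨(K.isRelLowerSet_faces hr).2 hx.2 ?_, hx.1.1, ?_⟩
    · by_contra h0
      rw [Finset.not_nonempty_iff_eq_empty, Finsupp.support_eq_empty] at h0
      have := hx.1.2
      rw [h0, map_zero] at this
      exact zero_ne_one this
    · rw [← coordSum_apply, hx.1.2]
  let f : Realization K' → Realization K := fun x => ⟨lin (pointWeight x), hmem x⟩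
  have hf : ∀ x, (f x).coord = lin (pointWeight x) := fun x => rfl
  have hcont : Continuous f := by
    refine Realization.continuous_of_forall_closedSimplex f fun s hs => ?_
    obtain ⟨r, hr, h⟩ := hface s hs
    refine Realization.continuous_of_forall_coord hr _
      (fun x => (lin_pointWeight_mem x.incl x.2 (convex_cell r) h).2) fun i => ?_
    have : (fun x : Realization.ClosedSimplex K' s => (f x.incl).coord i) =
        fun x => ∑ a ∈ s, x.incl.coord a * (a : ι →₀ ℝ) i := by
      funext x
      rw [hf, lin_pointWeight_of_subset x.incl x.2, Finsupp.finsetSum_apply]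
      rfl
    rw [this]
    exact continuous_finsetSum _ fun a _ =>
      (Realization.continuous_coord_closedSimplex a).mul continuous_const
  have hinj : Function.Injective f := by
    intro x y hxy
    have h1 : lin (pointWeight x) = lin (pointWeight y) := congrArg Realization.coord hxy
    exact Realization.coord_injective (Finsupp.embDomain_injective _
      (hU (pointWeight_nonneg x) (pointWeight_nonneg y) (support_pointWeight_mem x)
        (support_pointWeight_mem y) h1))
  have hL1 : ∀ A ∈ L, ∀ a ∈ A, {a} ∈ L := fun A hA a ha =>
    hL (Finset.singleton_subset_iff.2 ha) hA
  have hvert : ∀ A ∈ L, ∀ a ∈ A, a ∈ fullSimplex ι := fun A hA a ha =>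
    let ⟨r, _, h⟩ := hcell A hA ⟨a, ha⟩
    (h (Finset.mem_coe.2 ha)).1
  have hsur : Function.Surjective f := by
    intro y
    obtain ⟨t, ht, htL, hlin⟩ := hsurj y
    have hsum : (t.sum fun _ c => c) = 1 := by
      rw [← coordSum_lin fun a ha => (hvert _ htL a ha).2, hlin, coordSum_apply]
      exact y.2.2.2
    have hemb :
        (t.subtypeDomain fun a => {a} ∈ L).embDomain (Function.Embedding.subtype _) = t := by
      ext a
      by_cases ha : {a} ∈ L
      · exact (Finsupp.embDomain_apply_self _ _ (⟨a, ha⟩ : PointVertex L))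
      · rw [Finsupp.embDomain_of_notMem_range]
        · exact (Finsupp.notMem_support_iff.1 fun h => ha (hL1 _ htL a h)).symm
        · rintro ⟨b, rfl⟩
          exact ha b.2
    have hsupp : (t.subtypeDomain fun a => {a} ∈ L).support.map (Function.Embedding.subtype _)
        = t.support := by
      rw [← Finsupp.support_embDomain, hemb]
    obtain ⟨x, hx⟩ : ∃ x : Realization K', x.coord = t.subtypeDomain fun a => {a} ∈ L := by
      refine ⟨⟨t.subtypeDomain fun a => {a} ∈ L, ⟨?_, ?_⟩, fun a => ht a, ?_⟩, rfl⟩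
      · rw [← Finset.map_nonempty (f := Function.Embedding.subtype _), hsupp]
        by_contra h0
        rw [Finset.not_nonempty_iff_eq_empty, Finsupp.support_eq_empty] at h0
        rw [h0, Finsupp.sum_zero_index] at hsum
        exact zero_ne_one hsum
      · rw [hsupp]
        exact htL
      · rw [← hsum, Finsupp.sum, Finsupp.sum, ← hsupp, Finset.sum_map]
        rfl
    refine ⟨x, Realization.coord_injective ?_⟩
    rw [hf, ← hlin, pointWeight, hx, hemb]
  have hcomp : ∀ r ∈ K.faces, IsCompact (f ⁻¹' {x | x.coord.support ⊆ r}) := by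
    intro r hr
    have hfin' : {s : Finset (PointVertex L) | s ∈ K'.faces ∧
        ∀ a ∈ s, (a : ι →₀ ℝ) ∈ cell r}.Finite := by
      refine ((hfin r hr).preimage (f := fun s : Finset (PointVertex L) =>
        s.map (Function.Embedding.subtype _)) (Finset.map_injective _).injOn).subset ?_
      rintro s ⟨hs, hsr⟩
      refine ⟨hs.2, fun a ha => ?_⟩
      obtain ⟨b, hb, rfl⟩ := Finset.mem_map.1 (Finset.mem_coe.1 ha)
      exact hsr b hb
    have : f ⁻¹' {x | x.coord.support ⊆ r} = ⋃ s ∈ {s : Finset (PointVertex L) |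
        s ∈ K'.faces ∧ ∀ a ∈ s, (a : ι →₀ ℝ) ∈ cell r}, {x | x.coord.support ⊆ s} := by
      ext x
      simp only [mem_preimage, mem_ofPred_eq, mem_iUnion, exists_prop]
      constructor
      · intro hx
        rw [hf, support_lin_subset_iff (pointWeight_nonneg x)
          fun a ha => (hvert _ (support_pointWeight_mem x) a ha).1] at hx
        refine ⟨x.coord.support, ⟨x.2.1, fun a ha => ?_⟩, subset_rfl⟩
        have ha' : (a : ι →₀ ℝ) ∈ (pointWeight x).support := by
          rw [support_pointWeight]
          exact Finset.mem_map_of_mem _ ha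
        exact ⟨hvert _ (support_pointWeight_mem x) a ha', hx a ha'⟩
      · rintro ⟨s, ⟨-, hsr⟩, hxs⟩
        exact (lin_pointWeight_mem x hxs (convex_cell r) hsr).2
    rw [this]
    exact hfin'.isCompact_biUnion fun s hs => Realization.isCompact_closedSimplex hs.1
  have hbij : Function.Bijective f := ⟨hinj, hsur⟩
  refine ⟨_, pointComplex L hL, Realization.homeoOfBijective f hcont hbij hcomp,
    fun s hs x y hx hy => ?_⟩
  change dist (g (f x)) (g (f y)) < ε
  rw [← hG, ← hG, hf, hf]
  obtain ⟨ε', hε', hε''⟩ := hfine hs.2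
  have hconv : ∀ z : Realization K', z.coord.support ⊆ s → lin (pointWeight z) ∈
      convexHull ℝ (s.map (Function.Embedding.subtype _) : Set (ι →₀ ℝ)) := fun z hz =>
    lin_pointWeight_mem z hz (convex_convexHull ℝ _) fun a ha =>
      subset_convexHull ℝ _ (Finset.mem_coe.2 (Finset.mem_map_of_mem _ ha))
  exact (hε'' _ (hconv x hx) _ (hconv y hy)).trans_lt hε'

end fine

/-! ### Maps to the sphere -/

section sphere

universe u₁

variable {m d : ℕ}

/-- A map `f` is homotopic to `g` after radial projection if `f x` is always in the open half space
given by `g x`. -/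
theorem homotopyClass_radial_eq {X : Type u₁} [TopologicalSpace X] {r : E d} {f : C(X, E d)}
    (hf : ∀ x, f x ≠ r) (g : C(X, Sph d)) (h : ∀ x, 0 < inner ℝ (f x - r) (g x : E d)) :
    homotopyClass (radial r f hf) = homotopyClass g := by
  let g' : C(X, E d) := ⟨fun x => r + (g x : E d), by fun_prop⟩
  have hnorm : ∀ x, ‖(g x : E d)‖ = 1 := fun x => mem_sphere_zero_iff_norm.1 (g x).2
  have hg' : ∀ x, g' x ≠ r := by
    intro x hx
    have h0 : (g x : E d) = 0 := by simpa [g'] using hx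
    have := hnorm x
    rw [h0, norm_zero] at this
    exact zero_ne_one this
  have hrad : radial r g' hg' = g := by
    ext1 x
    apply Subtype.ext
    simp [radial, g', hnorm]
  rw [← hrad]
  refine radial_homotopic r f g' hf hg' fun x => ?_
  rintro ⟨a, b, ha, hb, hab, hr⟩
  have e : a • (f x - r) + b • (g x : E d) = 0 := by
    have e' : a • (f x - r) + b • (g x : E d) = (a • f x + b • g' x) - (a + b) • r := by
      change _ = (a • f x + b • (r + (g x : E d))) - (a + b) • r
      module
    rw [e', hr, hab, one_smul, sub_self]
  have e2 : a * inner ℝ (f x - r) (g x : E d) + b = 0 := by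
    have := congrArg (fun z => inner ℝ z (g x : E d)) e
    simpa [inner_add_left, real_inner_smul_left, hnorm] using this
  rcases ha.eq_or_lt with rfl | ha
  · linarith
  · have := mul_pos ha (h x)
    linarith

theorem ne_of_inner_pos {r y z : E d} (h : 0 < inner ℝ (z - r) y) : z ≠ r := by
  rintro rfl
  simp at h

theorem inner_pos_of_mem_convexHull {s : Set (E d)} {r y z : E d}
    (h : ∀ x ∈ s, 0 < inner ℝ (x - r) y) (hz : z ∈ convexHull ℝ s) : 0 < inner ℝ (z - r) y := by
  have hc : Convex ℝ {x : E d | 0 < inner ℝ (x - r) y} := by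
    have : {x : E d | 0 < inner ℝ (x - r) y} = {x | inner ℝ r y < inner ℝ x y} := by
      ext x
      simp [inner_sub_left]
    rw [this]
    exact convex_halfSpace_gt ⟨fun a b => inner_add_left a b y, fun c a => by
      simp [real_inner_smul_left]⟩ _
  exact convexHull_min h hc hz

theorem notMem_convexHull_of_inner_pos {s : Set (E d)} {r y : E d}
    (h : ∀ x ∈ s, 0 < inner ℝ (x - r) y) : r ∉ convexHull ℝ s := fun hr => by
  simpa using inner_pos_of_mem_convexHull h hr

/-- In each direction `y` there is some `v_i` at a distance from the interior point `r` that is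
bounded from below. -/
theorem exists_forall_exists_le_inner {v : Fin m → E d} {r : E d}
    (hr : r ∈ interior (convexHull ℝ (range v))) :
    ∃ c > 0, ∀ y : Sph d, ∃ i, c ≤ inner ℝ (v i - r) (y : E d) := by
  obtain ⟨ρ, hρ, hball⟩ := Metric.isOpen_iff.1 isOpen_interior r hr
  refine ⟨ρ / 2, half_pos hρ, fun y => ?_⟩
  by_contra! hcon
  have hy : ‖(y : E d)‖ = 1 := mem_sphere_zero_iff_norm.1 y.2
  have hz : r + (ρ / 2) • (y : E d) ∈ convexHull ℝ (range v) := by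
    refine interior_subset (hball ?_)
    rw [Metric.mem_ball, dist_self_add_left, norm_smul, hy, mul_one,
      Real.norm_of_nonneg (by positivity)]
    exact half_lt_self hρ
  -- Otherwise all `v_i` lie in the open half space beyond `r + (ρ / 2) y` in the direction `-y`,
  -- which therefore contains this point of the hull on its boundary.
  have := inner_pos_of_mem_convexHull (r := r + (ρ / 2) • (y : E d)) (y := -(y : E d)) (by
    rintro _ ⟨i, rfl⟩
    have := hcon i
    rw [inner_neg_right, ← sub_sub, inner_sub_left, real_inner_smul_left,
      real_inner_self_eq_norm_sq, hy]
    linarith) hz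
  simp at this

/-- Weights `max 0 ⟪v_i - r, y⟫`, normalized, define a map from the sphere to `|K(V, r)|`. -/
theorem exists_sphere_lift {v : Fin m → E d} {r : E d}
    (hr : r ∈ interior (convexHull ℝ (range v))) :
    ∃ σ : C(Sph d, Realization (nonBalancedComplex v r)), ∀ y i,
      i ∈ (σ y).coord.support → 0 < inner ℝ (v i - r) (y : E d) := by
  obtain ⟨c, hc, hex⟩ := exists_forall_exists_le_inner hr
  let w : Sph d → Fin m → ℝ := fun y i => max 0 (inner ℝ (v i - r) (y : E d))
  have hw0 : ∀ y i, 0 ≤ w y i := fun y i => le_max_left _ _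
  have hwc : ∀ i, Continuous fun y => w y i := fun i => by fun_prop
  have hW : ∀ y, 0 < ∑ i, w y i := fun y => by
    obtain ⟨i, hi⟩ := hex y
    exact Finset.sum_pos' (fun i _ => hw0 y i)
      ⟨i, Finset.mem_univ i, (hc.trans_le hi).trans_le (le_max_right _ _)⟩
  let q : Sph d → Fin m →₀ ℝ := fun y => Finsupp.equivFunOnFinite.symm fun i => w y i / ∑ j, w y j
  have hq : ∀ y i, q y i = w y i / ∑ j, w y j := fun y i => rfl
  have hpos : ∀ y i, i ∈ (q y).support → 0 < inner ℝ (v i - r) (y : E d) := by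
    intro y i hi
    by_contra! h
    exact Finsupp.mem_support_iff.1 hi (by rw [hq, show w y i = 0 from max_eq_left h, zero_div])
  have hsum : ∀ y, ∑ i, q y i = 1 := fun y => by
    simp only [hq]
    rw [← Finset.sum_div, div_self (hW y).ne']
  have hmem : ∀ y, (q y).support ∈ (nonBalancedComplex v r).faces ∧ (∀ i, 0 ≤ q y i) ∧
      ((q y).sum fun _ t => t) = 1 := by
    intro y
    refine ⟨⟨?_, ?_⟩, fun i => div_nonneg (hw0 y i) (hW y).le, ?_⟩
    · by_contra h0
      rw [Finset.not_nonempty_iff_eq_empty, Finsupp.support_eq_empty] at h0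
      have := hsum y
      simp [h0] at this
    · refine notMem_convexHull_of_inner_pos (y := (y : E d)) ?_
      rintro _ ⟨i, hi, rfl⟩
      exact hpos y i (Finset.mem_coe.1 hi)
    · rw [Finsupp.sum_fintype _ _ fun _ => rfl, hsum]
  let f : Sph d → Realization (nonBalancedComplex v r) := fun y => ⟨q y, hmem y⟩
  have hcoord : ∀ i, Continuous fun y => (f y).coord i := fun i => by
    change Continuous fun y => w y i / ∑ j, w y j
    exact (hwc i).div (continuous_finsetSum _ fun j _ => hwc j) fun y => (hW y).ne'
  refine ⟨⟨f, Realization.continuous_of_finite f hcoord⟩, hpos⟩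

/-- Every homotopy class is the class of the pullback of the star cover of `|K(V, r)|`. -/
theorem exists_cover {T : Type u₁} [TopologicalSpace T] [T2Space T] [ParacompactSpace T]
    {m d : ℕ} (v : Fin m → E d) (r : E d)
    (hr : r ∈ interior (convexHull ℝ (Set.range v)))
    (g : C(T, Sph d)) :
    ∃ (F : Fin m → Opens T) (hF : IsOpenCover F),
      coverClass v r F hF = some (homotopyClass g) ∧
      ∃ f : C(T, Realization (nonBalancedComplex v r)),
        homotopyClass ((nonBalancedSphereMap v r).comp f) = homotopyClass g ∧
        ∀ i, F i = Opens.comap f (Realization.openStar (nonBalancedComplex v r) i) := by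
  obtain ⟨σ, hσ⟩ := exists_sphere_lift hr
  let f := σ.comp g
  let F : Fin m → Opens T := fun i => Opens.comap f (Realization.openStar _ i)
  have hmem : ∀ i x, x ∈ F i ↔ i ∈ (f x).coord.support := fun i x => by
    rw [Finsupp.mem_support_iff]
    exact ⟨fun h : 0 < (f x).coord i => h.ne', fun h => lt_of_le_of_ne ((f x).2.2.1 i) (Ne.symm h)⟩
  have hF : IsOpenCover F := by
    refine IsOpenCover.mk (eq_top_iff.2 fun x _ => ?_)
    obtain ⟨i, hi⟩ := ((nonBalancedComplex v r).isRelLowerSet_faces (f x).2.1).1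
    exact Opens.mem_iSup.2 ⟨i, (hmem i x).2 hi⟩
  have hpos : ∀ x, ∀ z ∈ v '' {i | x ∈ F i}, 0 < inner ℝ (z - r) (g x : E d) := by
    rintro x _ ⟨i, hi, rfl⟩
    exact hσ (g x) i ((hmem i x).1 hi)
  have hB : NoBalancedSimplex v r F := by
    rintro I ⟨hne, x, hx⟩
    refine notMem_convexHull_of_inner_pos (y := (g x : E d)) ?_
    rintro _ ⟨i, hi, rfl⟩
    exact hpos x _ ⟨i, mem_iInter₂.1 hx i hi, rfl⟩
  refine ⟨F, hF, ?_, f, ?_, fun i => rfl⟩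
  · obtain ⟨Φ, hΦ⟩ := exists_partition F hF
    rw [coverClass_eq v r F hF hB Φ hΦ]
    exact congrArg some (homotopyClass_radial_eq _ g fun x =>
      inner_pos_of_mem_convexHull (hpos x) (rho_mem v Φ F hΦ x))
  · have hf : ∀ x, 0 < inner ℝ (Realization.affineMap _ v (f x) - r) (g x : E d) := fun x => by
      refine inner_pos_of_mem_convexHull ?_ (Realization.affineMap_mem v (f x))
      rintro _ ⟨i, hi, rfl⟩
      exact hσ (g x) i hi
    exact homotopyClass_radial_eq (f := (Realization.affineMap _ v).comp f)
      (fun x => ne_of_inner_pos (hf x)) g hf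

/-- Every homotopy class is the class of a coloring of a triangulation: on a fine triangulation,
each vertex `u` gets a color `i` for which `v_i` is far from `r` in the direction of the image of
`u`. -/
theorem exists_coloring {T : Type u₁} [TopologicalSpace T] {m d : ℕ} (v : Fin m → E d) (r : E d)
    (hr : r ∈ interior (convexHull ℝ (Set.range v))) (g : C(T, Sph d)) (K₀ : Triangulation T) :
    ∃ (K : Triangulation T) (L : K.Vertex → Fin m),
      colorClass v r K L = some (homotopyClass g) := by
  obtain ⟨c, hc, hex⟩ := exists_forall_exists_le_inner hr
  obtain ⟨B, hB0, hB⟩ : ∃ B > 0, ∀ i, ‖v i - r‖ ≤ B := by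
    refine ⟨1 + ∑ i, ‖v i - r‖, by positivity, fun i => ?_⟩
    have := Finset.single_le_sum (f := fun i => ‖v i - r‖) (fun i _ => norm_nonneg _)
      (Finset.mem_univ i)
    linarith
  let g' : C(T, E d) := ⟨fun x => (g x : E d), by fun_prop⟩
  obtain ⟨V, K', φ, hφ⟩ := exists_fine_triangulation
    (g'.comp (K₀.homeo : C(Realization K₀.complex.toPreAbstractSimplicialComplex, T)))
    (div_pos hc hB0)
  let K : Triangulation T := ⟨V, K', φ.trans K₀.homeo⟩
  let pt : V → Realization K'.toPreAbstractSimplicialComplex := fun u =>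
    ⟨Finsupp.single u 1, by
      rw [Finsupp.support_single _ one_ne_zero]
      exact K'.singleton_mem u, Finsupp.single_nonneg.2 zero_le_one, Finsupp.sum_single_index rfl⟩
  have hpt : ∀ u, (pt u).coord.support = {u} := fun u => Finsupp.support_single _ one_ne_zero
  choose L hL using fun u : V => hex (g (K.homeo (pt u)))
  -- The color of a vertex is good for all points of the simplices that contain the vertex.
  have hpos : ∀ s ∈ K'.faces, ∀ u ∈ s, ∀ x : Realization K'.toPreAbstractSimplicialComplex,
      x.coord.support ⊆ s → 0 < inner ℝ (v (L u) - r) (g (K.homeo x) : E d) := by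
    intro s hs u hu x hx
    have h1 : dist (g (K.homeo x) : E d) (g (K.homeo (pt u)) : E d) < c / B :=
      hφ s hs x (pt u) hx (by rw [hpt]; exact Finset.singleton_subset_iff.2 hu)
    have h2 := hL u
    have h3 : |inner ℝ (v (L u) - r) ((g (K.homeo x) : E d) - g (K.homeo (pt u)))| < c :=
      calc _ ≤ ‖v (L u) - r‖ * ‖(g (K.homeo x) : E d) - g (K.homeo (pt u))‖ :=
            abs_real_inner_le_norm _ _
        _ ≤ B * ‖(g (K.homeo x) : E d) - g (K.homeo (pt u))‖ := by
            gcongr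
            exact hB _
        _ < B * (c / B) := by
            rw [← dist_eq_norm]
            gcongr
        _ = c := mul_div_cancel₀ _ hB0.ne'
    rw [inner_sub_right] at h3
    linarith [(abs_lt.1 h3).1]
  have hbal : ∀ s ∈ K.complex.faces, ¬ IsBalanced v r (s.image L) := by
    intro s hs
    obtain ⟨u, hu⟩ := (K'.isRelLowerSet_faces hs).1
    refine notMem_convexHull_of_inner_pos (y := (g (K.homeo (pt u)) : E d)) ?_
    rintro _ ⟨i, hi, rfl⟩
    obtain ⟨u', hu', rfl⟩ := Finset.mem_image.1 (Finset.mem_coe.1 hi)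
    exact hpos s hs u' hu' (pt u) (by rw [hpt]; exact Finset.singleton_subset_iff.2 hu)
  refine ⟨K, L, ?_⟩
  have hf : ∀ x, 0 < inner ℝ (Realization.affineMap K.complex.toPreAbstractSimplicialComplex
      (v ∘ L) (K.homeo.symm x) - r) (g x : E d) := fun x => by
    refine inner_pos_of_mem_convexHull ?_ (Realization.affineMap_mem (v ∘ L) (K.homeo.symm x))
    rintro _ ⟨u, hu, rfl⟩
    have := hpos _ (K.homeo.symm x).2.1 u hu (K.homeo.symm x) (Finset.Subset.refl _)
    rwa [Homeomorph.apply_symm_apply] at this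
  rw [colorClass, dif_pos hbal]
  exact congrArg some (homotopyClass_radial_eq (f := (Realization.affineMap _ (v ∘ L)).comp
    (K.homeo.symm : C(T, Realization K.complex.toPreAbstractSimplicialComplex)))
    (fun x => ne_of_inner_pos (hf x)) g hf)

end sphere

end BalancedCover

theorem theorem4p3 {T : Type*} [TopologicalSpace T] [T2Space T] [ParacompactSpace T]
    {m d : ℕ} (v : Fin m → E d) (r : E d)
    (hrank : Module.finrank ℝ (vectorSpan ℝ (Set.range v)) = d)
    (hr : r ∈ interior (convexHull ℝ (Set.range v)))
    (h : HomotopyClass T (Sph d)) :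
    (∃ (F : Fin m → Opens T) (hF : IsOpenCover F),
      coverClass v r F hF = some h ∧
      ∃ f : C(T, Realization (nonBalancedComplex v r)),
        homotopyClass ((nonBalancedSphereMap v r).comp f) = h ∧
        ∀ i, F i = Opens.comap f (Realization.openStar (nonBalancedComplex v r) i)) ∧
    (Nonempty (Triangulation T) →
      ∃ (K : Triangulation T) (L : K.Vertex → Fin m), colorClass v r K L = some h) := by
  obtain ⟨g, rfl⟩ : ∃ g : C(T, Sph d), homotopyClass g = h := Quotient.exists_rep h
  exact ⟨exists_cover v r hr g, fun ⟨K₀⟩ => exists_coloring v r hr g K₀⟩
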